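/- Let $p>3$ be a prime, $\mathbb F=\mathbb F_p$ the prime field of characteristic $p$, $m=2r+1$ with $r\ge 0$, $n=2h$ with $h\ge 1$, $s=m+n$, and let $\underline t=(t_1,\dots,t_m)$ be an $m$-tuple of positive integers. Let $\mathcal O(m,n)=\mathcal O(m)\otimes\Lambda(n)$ be the tensor product of the divided power algebra with basis $x^{(\alpha)}$ ($\alpha\in\mathbb N^m$), $x^{(\alpha)}x^{(\beta)}=\binom{\alpha+\beta}{\alpha}x^{(\alpha+\beta)}$, and the exterior superalgebra on $x_{m+1},\dots,x_s$; it has the basis $x^{(\alpha)}x^u$, where $x^u$ is the product of the odd variables in $u\subseteq\{m+1,\dots,s\}$ in increasing order. Write $x_i=x^{(\varepsilon_i)}$ for $i\le m$, let $\partial_i$ ($1\le i\le s$) be the superderivations of $\mathcal O(m,n)$ with $\partial_i(x^{(\alpha)}x^u)=x^{(\alpha-\varepsilon_i)}x^u$ for $i\le m$ (zero if $\alpha_i=0$), and $\partial_i(x^{(\alpha)})=0$, $\partial_i(x_k)=\delta_{ik}$ ($k>m$) for $i>m$, and let $\mathrm p$ denote parity. Let $J=\{1,\dots,s\}\setminus\{m\}$.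 For $i\in J$ put $i'=i+r$ if $1\le i\le r$, $i'=i-r$ if $r<i\le 2r$, $i'=i+h$ if $m<i\le m+h$, $i'=i-h$ if $m+h<i\le s$; and $\sigma(i)=-1$ if $r<i\le 2r$, $\sigma(i)=1$ otherwise. For homogeneous $f\in\mathcal O(m,n)$ let $$D_K(f)=\sum_{i\in J}(-1)^{\mathrm p(\partial_i)\mathrm p(f)}\bigl(x_i\partial_m(f)+\sigma(i')\partial_{i'}(f)\bigr)\partial_i+\Bigl(2f-\sum_{i\in J}x_i\partial_i(f)\Bigr)\partial_m ,$$ extended linearly to all $f$. Let $\mathcal O(m,n;\underline t)$ be the span of the $x^{(\alpha)}x^u$ with $0\le\alpha_i\le p^{t_i}-1$ for all $i$, let $\widetilde K(m,n;\underline t)=D_K(\mathcal O(m,n;\underline t))$, with the supercommutator $[\cdot,\cdot]$ of operators on $\mathcal O(m,n)$ as bracket, and let $K=K(m,n;\underline t)=[\widetilde K(m,n;\underline t),\widetilde K(m,n;\underline t)]$ be its derived algebra, the contact Lie superalgebra. A skew-symmetric super-biderivation of $K$ of degree $\gamma\in\mathbb Z/2$ is a bilinear map $\phi:K\times K\to K$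 with $\phi(K_\alpha,K_\beta)\subseteq K_{\alpha+\beta+\gamma}$ such that, for all homogeneous $x,y,z\in K$ and with $\mathrm p(\phi)=\gamma$, $$\phi(x,y)=-(-1)^{\mathrm p(x)\mathrm p(y)}\phi(y,x),$$ $$\phi([x,y],z)=(-1)^{\mathrm p(\phi)\mathrm p(x)}[x,\phi(y,z)]+(-1)^{\mathrm p(y)\mathrm p(z)}[\phi(x,z),y],$$ $$\phi(x,[y,z])=[\phi(x,y),z]+(-1)^{(\mathrm p(\phi)+\mathrm p(x))\mathrm p(y)}[y,\phi(x,z)].$$ Let $\mathrm{BDer}_\gamma(K)$ be the space of these maps, $\mathrm{BDer}(K)=\mathrm{BDer}_{\bar 0}(K)+\mathrm{BDer}_{\bar 1}(K)$, and let $\mathrm{IBDer}(K)$ be the set of the inner ones, that is, of the maps $(x,y)\mapsto\lambda[x,y]$ with $\lambda\in\mathbb F$. Theorem. $\mathrm{BDer}(K)=\mathrm{IBDer}(K)$: the skew-symmetric super-biderivations of $K$ are exactly the maps $\phi(x,y)=\lambda[x,y]$ with a single scalar $\lambda\in\mathbb F$. -/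

import Mathlib

/-! ## Skew-symmetric super-biderivations of a superspace with a bracket -/

/-- The sign `(-1)^a` for `a ∈ ℤ/2`. -/
def superSign (F : Type*) [CommRing F] (a : ZMod 2) : F := (-1) ^ a.val

/-- `φ : L × L → L` is a skew-symmetric super-biderivation of `ℤ/2`-degree `γ` of the algebra `L`
with `ℤ/2`-grading `𝒢` and bracket `br`. -/
structure IsSkewSuperBiderivation {F L : Type*} [CommRing F] [AddCommGroup L] [Module F L]
    (𝒢 : ZMod 2 → Submodule F L) (br : L →ₗ[F] L →ₗ[F] L) (γ : ZMod 2)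
    (φ : L →ₗ[F] L →ₗ[F] L) : Prop where
  degree : ∀ a b : ZMod 2, ∀ x ∈ 𝒢 a, ∀ y ∈ 𝒢 b, φ x y ∈ 𝒢 (a + b + γ)
  skew : ∀ a b : ZMod 2, ∀ x ∈ 𝒢 a, ∀ y ∈ 𝒢 b, φ x y = -(superSign F (a * b) • φ y x)
  left : ∀ a b c : ZMod 2, ∀ x ∈ 𝒢 a, ∀ y ∈ 𝒢 b, ∀ z ∈ 𝒢 c,
    φ (br x y) z
      = superSign F (γ * a) • br x (φ y z) + superSign F (b * c) • br (φ x z) y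
  right : ∀ a b c : ZMod 2, ∀ x ∈ 𝒢 a, ∀ y ∈ 𝒢 b, ∀ z ∈ 𝒢 c,
    φ x (br y z) = br (φ x y) z + superSign F ((γ + a) * b) • br y (φ x z)

/-- `BDer_γ(L)`: the skew-symmetric super-biderivations of degree `γ`. -/
def superBDerHom {F L : Type*} [CommRing F] [AddCommGroup L] [Module F L]
    (𝒢 : ZMod 2 → Submodule F L) (br : L →ₗ[F] L →ₗ[F] L) (γ : ZMod 2) :
    Submodule F (L →ₗ[F] L →ₗ[F] L) where
  carrier := {φ | IsSkewSuperBiderivation 𝒢 br γ φ}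
  zero_mem' := by constructor <;> intros <;> simp
  add_mem' := by
    rintro φ ψ hφ hψ
    constructor
    · intro a b x hx y hy
      exact Submodule.add_mem _ (hφ.degree a b x hx y hy) (hψ.degree a b x hx y hy)
    · intro a b x hx y hy
      simp only [LinearMap.add_apply, hφ.skew a b x hx y hy, hψ.skew a b x hx y hy, smul_add]
      abel
    · intro a b c x hx y hy z hz
      simp only [LinearMap.add_apply, hφ.left a b c x hx y hy z hz,
        hψ.left a b c x hx y hy z hz, map_add, smul_add]
      abel
    · intro a b c x hx y hy z hz
      simp only [LinearMap.add_apply, hφ.right a b c x hx y hy z hz,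
        hψ.right a b c x hx y hy z hz, map_add, smul_add]
      abel
  smul_mem' := by
    rintro r φ hφ
    constructor
    · intro a b x hx y hy
      exact Submodule.smul_mem _ r (hφ.degree a b x hx y hy)
    · intro a b x hx y hy
      simp only [LinearMap.smul_apply, hφ.skew a b x hx y hy, smul_neg, smul_comm r]
    · intro a b c x hx y hy z hz
      simp only [LinearMap.smul_apply, hφ.left a b c x hx y hy z hz, map_smul, smul_add,
        smul_comm r]
    · intro a b c x hx y hy z hz
      simp only [LinearMap.smul_apply, hφ.right a b c x hx y hy z hz, map_smul, smul_add,
        smul_comm r]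

/-- `BDer(L) = BDer_0(L) + BDer_1(L)`. -/
def superBDer {F L : Type*} [CommRing F] [AddCommGroup L] [Module F L]
    (𝒢 : ZMod 2 → Submodule F L) (br : L →ₗ[F] L →ₗ[F] L) :
    Submodule F (L →ₗ[F] L →ₗ[F] L) :=
  superBDerHom 𝒢 br 0 ⊔ superBDerHom 𝒢 br 1

/-- `IBDer(L)`: the maps `(x, y) ↦ lam [x, y]` with a scalar `lam`. -/
def superIBDer {F L : Type*} [CommRing F] [AddCommGroup L] [Module F L]
    (br : L →ₗ[F] L →ₗ[F] L) : Submodule F (L →ₗ[F] L →ₗ[F] L) where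
  carrier := {φ | ∃ lam : F, ∀ x y : L, φ x y = lam • br x y}
  zero_mem' := ⟨0, fun x y => by simp⟩
  add_mem' := by
    rintro φ ψ ⟨a, ha⟩ ⟨b, hb⟩
    exact ⟨a + b, fun x y => by simp [ha, hb, add_smul]⟩
  smul_mem' := by
    rintro c φ ⟨a, ha⟩
    exact ⟨c * a, fun x y => by simp [ha, mul_smul]⟩

/-! ## The superalgebra `𝒪(m,n)` -/

namespace Contact

/-- The index `(α, u)` of the basis element `x^(α) x^u`; the odd variables
`x_{m+1}, …, x_{m+n}` are indexed by `Fin n`. -/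
abbrev Mon (m n : ℕ) : Type := (Fin m → ℕ) × Finset (Fin n)

/-- `𝒪(m,n) = 𝒪(m) ⊗ Λ(n)`, with basis `x^(α) x^u` (see `bas`) and product `mulO`. -/
def O (F : Type*) [CommRing F] (m n : ℕ) : Type _ := Mon m n →₀ F

noncomputable instance (F : Type*) [CommRing F] (m n : ℕ) : AddCommGroup (O F m n) :=
  inferInstanceAs (AddCommGroup (Mon m n →₀ F))

noncomputable instance (F : Type*) [CommRing F] (m n : ℕ) : Module F (O F m n) :=
  inferInstanceAs (Module F (Mon m n →₀ F))

/-- The indices of all variables, the even ones on the left and the odd ones on the right. -/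
abbrev Idx (m n : ℕ) : Type := Fin m ⊕ Fin n

section Algebra

variable (F : Type*) [CommRing F] (m n : ℕ)

/-- The basis of `𝒪(m,n)` whose elements are the monomials `x^(α) x^u`. -/
noncomputable def bas : Module.Basis (Mon m n) F (O F m n) :=
  Module.Basis.ofRepr (LinearEquiv.refl F (Mon m n →₀ F))

/-- `x^(α) x^u · x^(β) x^v = binom(α+β, α) x^(α+β) x^u x^v`, where `x^u x^v = 0` if `u` and `v`
meet, and otherwise `x^u x^v = (-1)^k x^(u ∪ v)`, `k` the number of inversions of `u` and `v`. -/
noncomputable def mulMon (a b : Mon m n) : O F m n :=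
  if Disjoint a.2 b.2 then
    ((∏ i, ((a.1 i + b.1 i).choose (a.1 i) : F))
        * (-1) ^ ((a.2 ×ˢ b.2).filter (fun q => q.2 < q.1)).card)
      • bas F m n (a.1 + b.1, a.2 ∪ b.2)
  else 0

/-- The product of `𝒪(m,n)`. -/
noncomputable def mulO : O F m n →ₗ[F] O F m n →ₗ[F] O F m n :=
  (bas F m n).constr F (fun a => (bas F m n).constr F (fun b => mulMon F m n a b))

/-- The variable `x_i`. -/
noncomputable def var : Idx m n → O F m n
  | Sum.inl i => bas F m n (Pi.single i 1, ∅)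
  | Sum.inr k => bas F m n (0, {k})

/-- The superderivation `∂_i`. For an odd index `k` it acts from the left:
`∂_k (x^(α) x^u) = (-1)^e x^(α) x^(u \ k)` if `k ∈ u`, `e` the number of elements of `u`
before `k`. -/
noncomputable def pd : Idx m n → Module.End F (O F m n)
  | Sum.inl i => (bas F m n).constr F (fun a =>
      if a.1 i = 0 then 0 else bas F m n (a.1 - Pi.single i 1, a.2))
  | Sum.inr k => (bas F m n).constr F (fun a =>
      if k ∈ a.2 then
        ((-1 : F) ^ (a.2.filter (fun j => j < k)).card) • bas F m n (a.1, a.2.erase k)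
      else 0)

/-- The parity component `𝒪(m,n)_γ`. -/
noncomputable def parO (γ : ZMod 2) : Submodule F (O F m n) :=
  Submodule.span F (bas F m n '' {a : Mon m n | (a.2.card : ZMod 2) = γ})

/-- The projection of `𝒪(m,n)` onto its component of parity `γ`. -/
noncomputable def projO (γ : ZMod 2) : Module.End F (O F m n) :=
  (bas F m n).constr F (fun a => if (a.2.card : ZMod 2) = γ then bas F m n a else 0)

/-- The linear map with `f ↦ (-1)^(p(∂_i) p(f)) f` for homogeneous `f`. -/
noncomputable def twist : Idx m n → Module.End F (O F m n)
  | Sum.inl _ => LinearMap.id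
  | Sum.inr _ => ∑ γ : ZMod 2, superSign F γ • projO F m n γ

/-- The vector field `f ∂_i`, that is, `g ↦ f · ∂_i(g)`, as a linear function of `f`. -/
noncomputable def field (i : Idx m n) : O F m n →ₗ[F] Module.End F (O F m n) :=
  (LinearMap.mulRight F (pd F m n i)) ∘ₗ mulO F m n

/-! ### The Lie superalgebra `End(𝒪(m,n))`, which contains `W(m,n)` -/

/-- The component of degree `γ` of a linear operator on `𝒪(m,n)`. -/
noncomputable def partEnd (γ : ZMod 2) :
    Module.End F (O F m n) →ₗ[F] Module.End F (O F m n) :=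
  ∑ β : ZMod 2,
    (LinearMap.mulLeft F (projO F m n (γ + β))) ∘ₗ (LinearMap.mulRight F (projO F m n β))

/-- The supercommutator: `[D, E] = D E - (-1)^(p(D) p(E)) E D` for homogeneous `D`, `E`. -/
noncomputable def superComm :
    Module.End F (O F m n) →ₗ[F] Module.End F (O F m n) →ₗ[F] Module.End F (O F m n) :=
  ∑ a : ZMod 2, ∑ b : ZMod 2,
    ((LinearMap.mul F (Module.End F (O F m n))).compl₁₂ (partEnd F m n a) (partEnd F m n b)
      - superSign F (a * b) •
        (LinearMap.mul F (Module.End F (O F m n))).flip.compl₁₂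
          (partEnd F m n a) (partEnd F m n b))

/-- The operators of degree `γ`, those that map `𝒪(m,n)_β` to `𝒪(m,n)_(γ+β)`. -/
noncomputable def parEnd (γ : ZMod 2) : Submodule F (Module.End F (O F m n)) where
  carrier := {D | ∀ β : ZMod 2, ∀ f ∈ parO F m n β, D f ∈ parO F m n (γ + β)}
  zero_mem' := fun _ _ _ => Submodule.zero_mem _
  add_mem' := fun hD hE β f hf => Submodule.add_mem _ (hD β f hf) (hE β f hf)
  smul_mem' := fun r _ hD β f hf => Submodule.smul_mem _ r (hD β f hf)

/-- `𝒪(m,n;t)`, spanned by the `x^(α) x^u` with `α_i ≤ π_i = p^(t_i) - 1` for all `i`. -/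
noncomputable def truncO (p : ℕ) (t : Fin m → ℕ) : Submodule F (O F m n) :=
  Submodule.span F (bas F m n '' {a : Mon m n | ∀ i, a.1 i ≤ p ^ t i - 1})

end Algebra

/-! ## The contact Lie superalgebra `K(m,n;t)`, `m = 2r+1`, `n = 2h` -/

/-- The involution `i ↦ i'` of a set of `2k` indices: `i' = i + k` for the first `k` of them and
`i' = i - k` for the others. -/
def conj (k : ℕ) (i : Fin (2 * k)) : Fin (2 * k) :=
  if hi : i.val < k then ⟨i.val + k, by omega⟩ else ⟨i.val - k, by omega⟩

section K

variable (F : Type*) [CommRing F] (r h : ℕ)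

/-- The set `J = I \ {m}`. -/
abbrev J : Type := Fin (2 * r) ⊕ Fin (2 * h)

/-- The inclusion of `J` in `I`. The missing index `m` is `Sum.inl (Fin.last (2 * r))`. -/
def J.toIdx {r h : ℕ} : J r h → Idx (2 * r + 1) (2 * h)
  | Sum.inl i => Sum.inl i.castSucc
  | Sum.inr k => Sum.inr k

/-- The involution `i ↦ i'` of `J`. -/
def J.conj {r h : ℕ} : J r h → J r h
  | Sum.inl i => Sum.inl (Contact.conj r i)
  | Sum.inr k => Sum.inr (Contact.conj h k)

/-- `σ(i) = -1` for `r < i ≤ 2r`, and `σ(i) = 1` for the other `i ∈ J`. -/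
def J.sigma {r h : ℕ} : J r h → F
  | Sum.inl i => if i.val < r then 1 else -1
  | Sum.inr _ => 1

/-- The index `m`. -/
def idxM : Idx (2 * r + 1) (2 * h) := Sum.inl (Fin.last (2 * r))

/-- For homogeneous `f`,
`D_K(f) = ∑_{i ∈ J} (-1)^(p(∂_i) p(f)) (x_i ∂_m(f) + σ(i') ∂_{i'}(f)) ∂_i
  + (2 f - ∑_{i ∈ J} x_i ∂_i(f)) ∂_m`. -/
noncomputable def DK :
    O F (2 * r + 1) (2 * h) →ₗ[F] Module.End F (O F (2 * r + 1) (2 * h)) :=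
  ∑ i : J r h, field F _ _ i.toIdx ∘ₗ
      (mulO F _ _ (var F _ _ i.toIdx) ∘ₗ pd F _ _ (idxM r h)
        + (i.conj.sigma F) • pd F _ _ i.conj.toIdx) ∘ₗ twist F _ _ i.toIdx
    + field F _ _ (idxM r h) ∘ₗ
      ((2 : F) • LinearMap.id
        - ∑ i : J r h, mulO F _ _ (var F _ _ i.toIdx) ∘ₗ pd F _ _ i.toIdx)

/-- `K̃(m,n;t)`, the image of `𝒪(m,n;t)` under `D_K`. -/
noncomputable def Ktilde (p : ℕ) (t : Fin (2 * r + 1) → ℕ) :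
    Submodule F (Module.End F (O F (2 * r + 1) (2 * h))) :=
  (truncO F (2 * r + 1) (2 * h) p t).map (DK F r h)

/-- `K(m,n;t) = [K̃, K̃]`, the derived algebra of `K̃(m,n;t)`: the subalgebra generated by the
brackets of elements of `K̃(m,n;t)`. (It is also their span, `K̃(m,n;t)` being a subalgebra.) -/
noncomputable def K (p : ℕ) (t : Fin (2 * r + 1) → ℕ) :
    Submodule F (Module.End F (O F (2 * r + 1) (2 * h))) :=
  sInf {N | (∀ D ∈ Ktilde F r h p t, ∀ E ∈ Ktilde F r h p t, superComm F _ _ D E ∈ N) ∧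
    ∀ D ∈ N, ∀ E ∈ N, superComm F _ _ D E ∈ N}

theorem superComm_mem_K (p : ℕ) (t : Fin (2 * r + 1) → ℕ)
    {D E : Module.End F (O F (2 * r + 1) (2 * h))} (hD : D ∈ K F r h p t)
    (hE : E ∈ K F r h p t) : superComm F _ _ D E ∈ K F r h p t := by
  refine (Submodule.mem_sInf).2 fun N hN => ?_
  exact hN.2 D ((Submodule.mem_sInf).1 hD N hN) E ((Submodule.mem_sInf).1 hE N hN)

/-- The bracket of `K(m,n;t)`. -/
noncomputable def bracketK (p : ℕ) (t : Fin (2 * r + 1) → ℕ) :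
    K F r h p t →ₗ[F] K F r h p t →ₗ[F] K F r h p t :=
  LinearMap.mk₂ F
    (fun D E => ⟨superComm F _ _ D.1 E.1, superComm_mem_K F r h p t D.2 E.2⟩)
    (fun _ _ _ => Subtype.ext (by simp)) (fun _ _ _ => Subtype.ext (by simp))
    (fun _ _ _ => Subtype.ext (by simp)) (fun _ _ _ => Subtype.ext (by simp))

/-- The `ℤ/2`-grading of `K(m,n;t)`. -/
noncomputable def parK (p : ℕ) (t : Fin (2 * r + 1) → ℕ) (γ : ZMod 2) :
    Submodule F (K F r h p t) :=
  (parEnd F (2 * r + 1) (2 * h) γ).comap (K F r h p t).subtype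

end K

end Contact

/-!
Every super-biderivation `φ` of `K = K(m,n;t)` is determined by the single value `φ(e, T)`, where
`e = D_K(1) = 2 ∂_m` and `T = D_K(x_m)` is the weighted Euler field, in which `x_m` has degree `2`
and the other variables have degree `1`.

For every Lie superalgebra, expanding `φ([x,u],[y,v])` in two ways gives
`[φ(x,y),[u,v]] = ± [[x,y],φ(u,v)]` (`IsSkewSuperBiderivation.br_apply_br`). In `K` the elements
`e`, `X_i = D_K(x_i)` and `T` are, up to the factor `2`, the brackets of `e` with `T`, with
`Y_i = D_K(x_i x_m)` and with `Q = D_K(x_m^(2))`, and an element that commutes with `e`, `T` and all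
`X_i` is zero. Hence `[x,y] = 0` implies `φ(x,y) = 0`, so that the superderivation `φ(e,·)`
supercommutes with the centralizer of `e`, and `φ(e,T)` commutes with `e` and the `X_i` and has
weight `-2` under `T`. The only such elements are the multiples of `e = [e,T]/2`; an odd one
is zero. After subtracting a multiple of the bracket, `φ(e,T) = 0`. Then `φ(e,Y_i)` and `φ(e,Q)`
commute with `e` and the `X_i` and have the weights `1` and `2`, so they vanish, because modulo
`p > 3` neither weight is `-1` or `-2`. By the identity above all values `φ(x,y)` now commute
with `e`, the `X_i` and `T`, and so `φ = 0` (`IsContactFrame.eq_zero_of_apply_e_T`).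

What is needed about `K` is that it is a graded subalgebra of the vector fields
`W(m,n) = ∑ 𝒪(m,n) ∂_i`. A vector field commuting with `e` and all `X_i` is determined by its
value at the origin, and `T` acts on it with the weight of the `∂_i` that occur in this value:
`-2` for `∂_m`, and `-1` for the others (`Contact.eq_zero_of_superComm_eq_zero`,
`Contact.constTerm_apply_var_of_weight`).
-/

section Signs

variable (F : Type*) [CommRing F]

theorem superSign_natCast (k : ℕ) : superSign F (k : ZMod 2) = (-1) ^ k := by
  rw [superSign, ZMod.val_natCast, ← neg_one_pow_eq_pow_mod_two]

@[simp] theorem superSign_zero : superSign F 0 = 1 := by simp [superSign]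

@[simp] theorem superSign_one : superSign F 1 = -1 := by simp [superSign, ZMod.val_one]

theorem ZMod.two_cases (a : ZMod 2) : a = 0 ∨ a = 1 := by
  revert a
  decide

end Signs

namespace Contact

/-! ### The superalgebra `𝒪(m,n)` -/

section Inversions

variable {n : ℕ}

/-- The number of inversions of `u` and `v`: of the pairs `(i, j)` in `u × v` with `j < i`. -/
def inversions (u v : Finset (Fin n)) : ℕ := ((u ×ˢ v).filter (fun q => q.2 < q.1)).card

theorem inversions_union_left {u v : Finset (Fin n)} (w : Finset (Fin n)) (huv : Disjoint u v) :
    inversions (u ∪ v) w = inversions u w + inversions v w := by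
  rw [inversions, Finset.union_product, Finset.filter_union, Finset.card_union_of_disjoint]
  · rfl
  · refine Finset.disjoint_filter_filter (Finset.disjoint_left.2 fun q h1 h2 => ?_)
    exact Finset.disjoint_left.1 huv (Finset.mem_product.1 h1).1 (Finset.mem_product.1 h2).1

theorem inversions_union_right (w : Finset (Fin n)) {u v : Finset (Fin n)} (huv : Disjoint u v) :
    inversions w (u ∪ v) = inversions w u + inversions w v := by
  rw [inversions, Finset.product_union, Finset.filter_union, Finset.card_union_of_disjoint]
  · rfl
  · refine Finset.disjoint_filter_filter (Finset.disjoint_left.2 fun q h1 h2 => ?_)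
    exact Finset.disjoint_left.1 huv (Finset.mem_product.1 h1).2 (Finset.mem_product.1 h2).2

theorem inversions_add_swap {u v : Finset (Fin n)} (huv : Disjoint u v) :
    inversions u v + inversions v u = u.card * v.card := by
  have h : inversions v u = ((u ×ˢ v).filter (fun q => ¬ q.2 < q.1)).card := by
    refine Finset.card_bij (fun q _ => q.swap) ?_ ?_ ?_
    · rintro ⟨a, b⟩ hq
      simp only [Finset.mem_filter, Finset.mem_product, Prod.swap] at hq ⊢
      exact ⟨⟨hq.1.2, hq.1.1⟩, not_lt.2 hq.2.le⟩
    · intro a _ b _ hab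
      exact Prod.swap_injective hab
    · rintro ⟨a, b⟩ hq
      simp only [Finset.mem_filter, Finset.mem_product] at hq
      refine ⟨(b, a), ?_, rfl⟩
      simp only [Finset.mem_filter, Finset.mem_product]
      refine ⟨⟨hq.1.2, hq.1.1⟩, lt_of_le_of_ne (not_lt.1 hq.2) ?_⟩
      rintro rfl
      exact Finset.disjoint_left.1 huv hq.1.1 hq.1.2
  rw [h, inversions, Finset.card_filter_add_card_filter_not, Finset.card_product]

theorem inversions_singleton_left (k : Fin n) (v : Finset (Fin n)) :
    inversions {k} v = (v.filter (fun j => j < k)).card := by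
  rw [inversions, Finset.singleton_product, Finset.filter_map, Finset.card_map]
  rfl

@[simp] theorem inversions_empty_left (v : Finset (Fin n)) : inversions ∅ v = 0 := by
  simp [inversions]

@[simp] theorem inversions_empty_right (v : Finset (Fin n)) : inversions v ∅ = 0 := by
  simp [inversions]

theorem inversions_erase_left {u : Finset (Fin n)} {k : Fin n} (hk : k ∈ u)
    (v : Finset (Fin n)) : inversions u v = inversions {k} v + inversions (u.erase k) v := by
  rw [← inversions_union_left v (by simp), Finset.singleton_union, Finset.insert_erase hk]

theorem inversions_erase_right (u : Finset (Fin n)) {v : Finset (Fin n)} {k : Fin n}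
    (hk : k ∈ v) : inversions u v = inversions u {k} + inversions u (v.erase k) := by
  rw [← inversions_union_right u (by simp), Finset.singleton_union, Finset.insert_erase hk]

end Inversions

section Binomials

/-- The structure constant of the divided power algebra: `x^(a) x^(b) = divCoeff a b • x^(a+b)`. -/
def divCoeff (F : Type*) [CommRing F] {m : ℕ} (a b : Fin m → ℕ) : F :=
  ∏ i, ((a i + b i).choose (a i) : F)

variable {F : Type*} [CommRing F] {m : ℕ}

theorem divCoeff_comm (a b : Fin m → ℕ) : divCoeff F a b = divCoeff F b a := by
  refine Finset.prod_congr rfl fun i _ => ?_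
  rw [Nat.choose_symm_add, add_comm]

theorem divCoeff_assoc (a b c : Fin m → ℕ) :
    divCoeff F a b * divCoeff F (a + b) c = divCoeff F b c * divCoeff F a (b + c) := by
  rw [divCoeff, divCoeff, divCoeff, divCoeff, ← Finset.prod_mul_distrib,
    ← Finset.prod_mul_distrib]
  refine Finset.prod_congr rfl fun i _ => ?_
  norm_cast
  simp only [Pi.add_apply]
  have h := Nat.choose_mul (n := a i + b i + c i) (k := a i + b i) (s := a i)
    (by omega)
  rw [show a i + b i + c i - a i = b i + c i by omega, show a i + b i - a i = b i by omega] at h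
  rw [mul_comm, h, mul_comm, add_assoc]

@[simp] theorem divCoeff_zero_left (b : Fin m → ℕ) : divCoeff F 0 b = 1 := by
  simp [divCoeff]

@[simp] theorem divCoeff_zero_right (b : Fin m → ℕ) : divCoeff F b 0 = 1 := by
  simp [divCoeff]

theorem divCoeff_eq (a b : Fin m → ℕ) (i : Fin m) :
    divCoeff F a b = ((a i + b i).choose (a i) : F) *
      ∏ j ∈ Finset.univ.erase i, ((a j + b j).choose (a j) : F) :=
  (Finset.mul_prod_erase _ _ (Finset.mem_univ i)).symm

theorem divCoeff_single (b : Fin m → ℕ) (i : Fin m) :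
    divCoeff F (Pi.single i 1) b = ((b i + 1 : ℕ) : F) := by
  rw [divCoeff_eq _ _ i, Finset.prod_eq_one]
  · simp [add_comm]
  · intro j hj
    simp [Finset.ne_of_mem_erase hj]

/-- Pascal's rule for the structure constants. -/
theorem divCoeff_pascal (a b : Fin m → ℕ) (i : Fin m) (ha : a i ≠ 0) (hb : b i ≠ 0) :
    divCoeff F a b
      = divCoeff F (a - Pi.single i 1) b + divCoeff F a (b - Pi.single i 1) := by
  have h1 : ∏ j ∈ Finset.univ.erase i, ((((a - Pi.single i 1 : Fin m → ℕ) j + b j).choose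
        ((a - Pi.single i 1 : Fin m → ℕ) j) : ℕ) : F)
      = ∏ j ∈ Finset.univ.erase i, ((a j + b j).choose (a j) : F) := by
    refine Finset.prod_congr rfl fun j hj => ?_
    simp [Finset.ne_of_mem_erase hj]
  have h2 : ∏ j ∈ Finset.univ.erase i,
        (((a j + (b - Pi.single i 1 : Fin m → ℕ) j).choose (a j) : ℕ) : F)
      = ∏ j ∈ Finset.univ.erase i, ((a j + b j).choose (a j) : F) := by
    refine Finset.prod_congr rfl fun j hj => ?_
    simp [Finset.ne_of_mem_erase hj]
  rw [divCoeff_eq _ _ i, divCoeff_eq _ b i, divCoeff_eq a (b - _) i, h1, h2, ← add_mul]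
  congr 1
  obtain ⟨k, hk⟩ := Nat.exists_eq_succ_of_ne_zero ha
  obtain ⟨l, hl⟩ := Nat.exists_eq_succ_of_ne_zero hb
  simp only [Pi.sub_apply, Pi.single_eq_same, hk, hl, Nat.succ_eq_add_one, Nat.add_sub_cancel]
  rw [show k + 1 + (l + 1) = (k + (l + 1)) + 1 by ring, Nat.choose_succ_succ,
    show k + 1 + l = k + (l + 1) by ring]
  push_cast
  ring

theorem divCoeff_sub_left (a b : Fin m → ℕ) (i : Fin m) (hb : b i = 0) :
    divCoeff F (a - Pi.single i 1) b = divCoeff F a b := by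
  refine Finset.prod_congr rfl fun j _ => ?_
  rcases eq_or_ne j i with rfl | hj
  · simp [hb]
  · simp [hj]

theorem divCoeff_sub_right (a b : Fin m → ℕ) (i : Fin m) (ha : a i = 0) :
    divCoeff F a (b - Pi.single i 1) = divCoeff F a b := by
  rw [divCoeff_comm, divCoeff_sub_left b a i ha, divCoeff_comm]

end Binomials

section Algebra

variable {F : Type*} [CommRing F] {m n : ℕ}

local notation:70 f:70 " ⋆ " g:71 => mulO _ _ _ f g

/-- The degree of a variable in `ℤ/2`. -/
def Idx.par : Idx m n → ZMod 2
  | Sum.inl _ => 0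
  | Sum.inr _ => 1

theorem mulO_bas (a b : Mon m n) : bas F m n a ⋆ bas F m n b = mulMon F m n a b := by
  simp [mulO]

theorem mulO_bas_of_disjoint {a b : Mon m n} (hab : Disjoint a.2 b.2) :
    bas F m n a ⋆ bas F m n b
      = (divCoeff F a.1 b.1 * (-1) ^ inversions a.2 b.2)
        • bas F m n (a.1 + b.1, a.2 ∪ b.2) := by
  rw [mulO_bas, mulMon, if_pos hab]
  rfl

theorem mulO_bas_of_not_disjoint {a b : Mon m n} (hab : ¬ Disjoint a.2 b.2) :
    bas F m n a ⋆ bas F m n b = 0 := by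
  rw [mulO_bas, mulMon, if_neg hab]

theorem pd_inl_bas (i : Fin m) (a : Mon m n) :
    pd F m n (Sum.inl i) (bas F m n a)
      = if a.1 i = 0 then 0 else bas F m n (a.1 - Pi.single i 1, a.2) := by
  simp [pd]

theorem pd_inr_bas (k : Fin n) (a : Mon m n) :
    pd F m n (Sum.inr k) (bas F m n a)
      = if k ∈ a.2 then ((-1 : F) ^ inversions {k} a.2) • bas F m n (a.1, a.2.erase k)
        else 0 := by
  simp [pd, inversions_singleton_left]

theorem mulO_assoc_bas (a b c : Mon m n) :
    (bas F m n a ⋆ bas F m n b) ⋆ bas F m n c = bas F m n a ⋆ (bas F m n b ⋆ bas F m n c) := by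
  by_cases hab : Disjoint a.2 b.2
  · by_cases hc : Disjoint (a.2 ∪ b.2) c.2
    · have hac := (Finset.disjoint_union_left.1 hc).1
      have hbc := (Finset.disjoint_union_left.1 hc).2
      have ha : Disjoint a.2 (b.2 ∪ c.2) := Finset.disjoint_union_right.2 ⟨hab, hac⟩
      rw [mulO_bas_of_disjoint hab, mulO_bas_of_disjoint hbc, map_smul, map_smul,
        LinearMap.smul_apply, mulO_bas_of_disjoint hc, mulO_bas_of_disjoint ha, smul_smul,
        smul_smul]
      simp only [inversions_union_left _ hab, inversions_union_right _ hbc, add_assoc,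
        Finset.union_assoc]
      congr 1
      have := divCoeff_assoc (F := F) a.1 b.1 c.1
      rw [pow_add, pow_add]
      linear_combination
        ((-1) ^ inversions a.2 b.2 * (-1) ^ inversions a.2 c.2 * (-1) ^ inversions b.2 c.2) * this
    · rw [mulO_bas_of_disjoint hab, map_smul, LinearMap.smul_apply,
        mulO_bas_of_not_disjoint hc, smul_zero]
      by_cases hbc : Disjoint b.2 c.2
      · have ha : ¬ Disjoint a.2 (b.2 ∪ c.2) := fun h =>
          hc (Finset.disjoint_union_left.2 ⟨(Finset.disjoint_union_right.1 h).2, hbc⟩)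
        rw [mulO_bas_of_disjoint hbc, map_smul, mulO_bas_of_not_disjoint ha, smul_zero]
      · rw [mulO_bas_of_not_disjoint hbc, map_zero]
  · rw [mulO_bas_of_not_disjoint hab, map_zero, LinearMap.zero_apply]
    by_cases hbc : Disjoint b.2 c.2
    · have ha : ¬ Disjoint a.2 (b.2 ∪ c.2) := fun h => hab (Finset.disjoint_union_right.1 h).1
      rw [mulO_bas_of_disjoint hbc, map_smul, mulO_bas_of_not_disjoint ha, smul_zero]
    · rw [mulO_bas_of_not_disjoint hbc, map_zero]

theorem O.induction {P : O F m n → Prop} (hb : ∀ a, P (bas F m n a))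
    (hadd : ∀ f g, P f → P g → P (f + g)) (hsmul : ∀ (c : F) f, P f → P (c • f))
    (f : O F m n) : P f := by
  have hf : f ∈ Submodule.span F (Set.range (bas F m n)) := by
    rw [(bas F m n).span_eq]; trivial
  induction hf using Submodule.span_induction with
  | mem x hx => obtain ⟨a, rfl⟩ := hx; exact hb a
  | zero => simpa using hsmul 0 _ (hb (0, ∅))
  | add x y _ _ hx hy => exact hadd x y hx hy
  | smul c x _ hx => exact hsmul c x hx

theorem mulO_assoc (f g k : O F m n) : (f ⋆ g) ⋆ k = f ⋆ (g ⋆ k) := by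
  induction f using O.induction with
  | hadd f f' hf hf' => simp only [map_add, LinearMap.add_apply, hf, hf']
  | hsmul c f hf => simp only [map_smul, LinearMap.smul_apply, hf]
  | hb a =>
    induction g using O.induction with
    | hadd f f' hf hf' => simp only [map_add, LinearMap.add_apply, hf, hf']
    | hsmul c f hf => simp only [map_smul, LinearMap.smul_apply, hf]
    | hb b =>
      induction k using O.induction with
      | hadd f f' hf hf' => simp only [map_add, hf, hf']
      | hsmul c f hf => simp only [map_smul, hf]
      | hb c => exact mulO_assoc_bas a b c

theorem mulO_comm_bas (a b : Mon m n) :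
    bas F m n a ⋆ bas F m n b
      = superSign F ((a.2.card : ZMod 2) * b.2.card) • (bas F m n b ⋆ bas F m n a) := by
  by_cases hab : Disjoint a.2 b.2
  · rw [mulO_bas_of_disjoint hab, mulO_bas_of_disjoint hab.symm, smul_smul, ← Nat.cast_mul,
      superSign_natCast, divCoeff_comm, ← inversions_add_swap hab, add_comm b.1,
      Finset.union_comm b.2, pow_add]
    congr 1
    have : ((-1 : F) ^ inversions b.2 a.2) * (-1) ^ inversions b.2 a.2 = 1 := by
      rw [← mul_pow]; simp
    linear_combination (-divCoeff F b.1 a.1 * (-1) ^ inversions a.2 b.2) * this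
  · rw [mulO_bas_of_not_disjoint hab, mulO_bas_of_not_disjoint (fun h => hab h.symm), smul_zero]

theorem one_mulO (f : O F m n) : bas F m n (0, ∅) ⋆ f = f := by
  have h : mulO F m n (bas F m n (0, ∅)) = LinearMap.id := by
    refine (bas F m n).ext fun a => ?_
    rw [mulO_bas_of_disjoint (by simp)]
    simp
  rw [h, LinearMap.id_apply]

theorem mulO_one (f : O F m n) : f ⋆ bas F m n (0, ∅) = f := by
  have h : (mulO F m n).flip (bas F m n (0, ∅)) = LinearMap.id := by
    refine (bas F m n).ext fun a => ?_
    rw [LinearMap.flip_apply, mulO_bas_of_disjoint (by simp)]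
    simp
  rw [← LinearMap.flip_apply, h, LinearMap.id_apply]

theorem pd_inl_mulO_bas (i : Fin m) (a b : Mon m n) :
    pd F m n (Sum.inl i) (bas F m n a ⋆ bas F m n b)
      = pd F m n (Sum.inl i) (bas F m n a) ⋆ bas F m n b
        + bas F m n a ⋆ pd F m n (Sum.inl i) (bas F m n b) := by
  have hz (c d : Fin m → ℕ) (hc : c i ≠ 0) :
      c + d - Pi.single i 1 = c - Pi.single i 1 + d := by
    ext j
    rcases eq_or_ne j i with rfl | hj
    · simp; omega
    · simp [hj]
  by_cases hab : Disjoint a.2 b.2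
  · rw [mulO_bas_of_disjoint hab, map_smul, pd_inl_bas, pd_inl_bas, pd_inl_bas]
    by_cases ha : a.1 i = 0
    · by_cases hb : b.1 i = 0
      · simp [ha, hb]
      · rw [if_neg (by simp [hb]), if_pos ha, if_neg hb, map_zero, LinearMap.zero_apply, zero_add,
          mulO_bas_of_disjoint (by exact hab)]
        simp only
        rw [divCoeff_sub_right _ _ _ ha, add_comm a.1, hz _ _ hb, add_comm a.1]
    · by_cases hb : b.1 i = 0
      · rw [if_neg (by simp [ha]), if_pos hb, if_neg ha, map_zero, add_zero,
          mulO_bas_of_disjoint (by exact hab)]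
        simp only
        rw [divCoeff_sub_left _ _ _ hb, hz _ _ ha]
      · rw [if_neg (by simp [ha]), if_neg hb, if_neg ha, mulO_bas_of_disjoint (by exact hab),
          mulO_bas_of_disjoint (by exact hab)]
        simp only
        rw [divCoeff_pascal _ _ i ha hb, hz _ _ ha, ← hz _ _ ha, add_comm a.1 (b.1 - _),
          ← hz _ _ hb, add_comm b.1, add_mul, add_smul]
  · rw [mulO_bas_of_not_disjoint hab, map_zero, pd_inl_bas, pd_inl_bas]
    split_ifs <;> simp [mulO_bas_of_not_disjoint
      (show ¬ Disjoint ((a.1 - Pi.single i 1, a.2) : Mon m n).2 b.2 from hab),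
      mulO_bas_of_not_disjoint
      (show ¬ Disjoint a.2 ((b.1 - Pi.single i 1, b.2) : Mon m n).2 from hab)]

theorem neg_one_pow_eq_of_mod_two {x y : ℕ} (hxy : x % 2 = y % 2) :
    (-1 : F) ^ x = (-1) ^ y := by
  rw [neg_one_pow_eq_pow_mod_two, hxy, ← neg_one_pow_eq_pow_mod_two]

theorem neg_one_pow_succ (x : ℕ) : (-1 : F) ^ (x + 1) = -(-1) ^ x := by
  rw [pow_succ, mul_neg_one]

theorem pd_inr_mulO_bas (k : Fin n) (a b : Mon m n) :
    pd F m n (Sum.inr k) (bas F m n a ⋆ bas F m n b)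
      = pd F m n (Sum.inr k) (bas F m n a) ⋆ bas F m n b
        + ((-1 : F) ^ a.2.card) • (bas F m n a ⋆ pd F m n (Sum.inr k) (bas F m n b)) := by
  rw [pd_inr_bas k a, pd_inr_bas k b]
  obtain ⟨a, u⟩ := a
  obtain ⟨b, v⟩ := b
  simp only
  have hswap (w : Finset (Fin n)) (hw : k ∉ w) :
      inversions {k} w + inversions w {k} = w.card := by
    rw [inversions_add_swap (by simpa using hw)]; simp
  have hkk : inversions ({k} : Finset (Fin n)) {k} = 0 := by
    simp [inversions]
  by_cases hab : Disjoint u v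
  · rw [mulO_bas_of_disjoint (by exact hab), map_smul, pd_inr_bas]
    simp only [Finset.mem_union]
    by_cases hu : k ∈ u
    · have hv : k ∉ v := Finset.disjoint_left.1 hab hu
      have hd : Disjoint (u.erase k) v := Finset.disjoint_of_subset_left (u.erase_subset k) hab
      rw [if_pos (Or.inl hu), if_pos hu, if_neg hv, map_zero, smul_zero, add_zero, map_smul,
        LinearMap.smul_apply, mulO_bas_of_disjoint (by exact hd), smul_smul, smul_smul,
        Finset.erase_union_distrib, Finset.erase_eq_of_notMem hv]
      congr 1
      rw [mul_assoc, ← pow_add, mul_left_comm, ← pow_add]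
      congr 1
      apply neg_one_pow_eq_of_mod_two
      have := inversions_union_right {k} hab
      have := inversions_erase_left hu v
      dsimp only
      omega
    · by_cases hv : k ∈ v
      · have hd : Disjoint u (v.erase k) :=
          Finset.disjoint_of_subset_right (v.erase_subset k) hab
        rw [if_pos (Or.inr hv), if_neg hu, if_pos hv, map_zero, LinearMap.zero_apply, zero_add,
          map_smul, mulO_bas_of_disjoint (by exact hd), smul_smul, smul_smul, smul_smul,
          Finset.erase_union_distrib, Finset.erase_eq_of_notMem hu]
        congr 1
        rw [mul_assoc, ← pow_add, mul_left_comm, ← pow_add, ← pow_add]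
        congr 1
        apply neg_one_pow_eq_of_mod_two
        have := inversions_union_right {k} hab
        have := inversions_erase_right u hv
        have := hswap u hu
        dsimp only
        omega
      · rw [if_neg (by tauto), if_neg hu, if_neg hv]
        simp
  · rw [mulO_bas_of_not_disjoint (by exact hab), map_zero]
    by_cases hu : k ∈ u
    · by_cases hv : k ∈ v
      · rw [if_pos hu, if_pos hv, map_smul, map_smul, LinearMap.smul_apply]
        by_cases hd : Disjoint (u.erase k) v
        · -- Here `u` and `v` meet exactly in `k`, and the two terms cancel.
          have hd' : Disjoint u (v.erase k) := by
            rw [Finset.disjoint_left] at hd ⊢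
            intro x hx hxv
            exact hd (Finset.mem_erase.2 ⟨Finset.ne_of_mem_erase hxv, hx⟩)
              (Finset.mem_of_mem_erase hxv)
          rw [mulO_bas_of_disjoint (by exact hd), mulO_bas_of_disjoint (by exact hd'), smul_smul,
            smul_smul, smul_smul]
          simp only
          rw [Finset.erase_union_of_mem hv, Finset.union_erase_of_mem hu, ← add_smul]
          have h1 := inversions_erase_right {k} hu
          have h2 := inversions_erase_right (u.erase k) hv
          have h3 := inversions_erase_left hu (v.erase k)
          have h4 := inversions_erase_right {k} hv
          have h5 := hswap (u.erase k) (by simp)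
          have h6 := Finset.card_erase_add_one hu
          have h7 : (-1 : F) ^ inversions {k} u * (-1) ^ inversions (u.erase k) v
              = - ((-1) ^ u.card * (-1) ^ inversions {k} v * (-1) ^ inversions u (v.erase k)) := by
            rw [← pow_add, ← pow_add, ← pow_add, ← neg_one_pow_succ]
            apply neg_one_pow_eq_of_mod_two
            omega
          rw [show (-1 : F) ^ inversions {k} u * (divCoeff F a b * (-1) ^ inversions (u.erase k) v)
            + (-1) ^ u.card * (-1) ^ inversions {k} v *
              (divCoeff F a b * (-1) ^ inversions u (v.erase k)) = 0 by
              linear_combination divCoeff F a b * h7, zero_smul]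
        · have hd' : ¬ Disjoint u (v.erase k) := by
            rw [Finset.disjoint_left] at hd ⊢
            intro h
            refine hd fun x hx hxv => h (Finset.mem_of_mem_erase hx)
              (Finset.mem_erase.2 ⟨Finset.ne_of_mem_erase hx, hxv⟩)
          rw [mulO_bas_of_not_disjoint (by exact hd), mulO_bas_of_not_disjoint (by exact hd')]
          simp
      · have hd : ¬ Disjoint (u.erase k) v := by
          rw [Finset.disjoint_left] at hab ⊢
          intro h
          exact hab fun x hx hxv => h (Finset.mem_erase.2 ⟨fun hxk => hv (hxk ▸ hxv), hx⟩) hxv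
        rw [if_pos hu, if_neg hv, map_smul, LinearMap.smul_apply,
          mulO_bas_of_not_disjoint (by exact hd)]
        simp
    · rw [if_neg hu]
      by_cases hv : k ∈ v
      · have hd : ¬ Disjoint u (v.erase k) := by
          rw [Finset.disjoint_left] at hab ⊢
          intro h
          exact hab fun x hx hxv => h hx (Finset.mem_erase.2 ⟨fun hxk => hu (hxk ▸ hx), hxv⟩)
        rw [if_pos hv, map_smul, mulO_bas_of_not_disjoint (by exact hd)]
        simp
      · rw [if_neg hv]
        simp

/-- `∂_i` is a superderivation. -/
theorem pd_mulO_bas (i : Idx m n) (a : Mon m n) (f : O F m n) :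
    pd F m n i (bas F m n a ⋆ f) = pd F m n i (bas F m n a) ⋆ f
      + superSign F (i.par * a.2.card) • (bas F m n a ⋆ pd F m n i f) := by
  induction f using O.induction with
  | hadd f g hf hg => simp only [map_add, hf, hg, smul_add]; abel
  | hsmul c f hf => simp only [map_smul, hf, smul_add, smul_comm c]
  | hb b =>
    rcases i with i | k
    · simp [Idx.par, pd_inl_mulO_bas]
    · rw [pd_inr_mulO_bas, Idx.par, one_mul, superSign_natCast]

/-- The `∂_i` supercommute. -/
theorem pd_pd_comm (i j : Idx m n) (f : O F m n) :
    pd F m n i (pd F m n j f) = superSign F (i.par * j.par) • pd F m n j (pd F m n i f) := by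
  induction f using O.induction with
  | hadd f g hf hg => simp only [map_add, hf, hg, smul_add]
  | hsmul c f hf => simp only [map_smul, hf, smul_comm c]
  | hb b =>
    obtain ⟨b, v⟩ := b
    rcases i with i | k <;> rcases j with j | l
    · simp only [Idx.par, mul_zero, superSign_zero, one_smul]
      rcases eq_or_ne i j with rfl | hij
      · rfl
      · rw [pd_inl_bas, pd_inl_bas]
        by_cases hi : b i = 0 <;> by_cases hj : b j = 0 <;>
          simp [hi, hj, pd_inl_bas, hij, hij.symm, tsub_right_comm]
    · simp only [Idx.par, zero_mul, superSign_zero, one_smul]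
      rw [pd_inl_bas, pd_inr_bas]
      by_cases hi : b i = 0 <;> by_cases hj : l ∈ v <;> simp [hi, hj, pd_inl_bas, pd_inr_bas]
    · simp only [Idx.par, mul_zero, superSign_zero, one_smul]
      rw [pd_inl_bas, pd_inr_bas]
      by_cases hi : b j = 0 <;> by_cases hj : k ∈ v <;> simp [hi, hj, pd_inl_bas, pd_inr_bas]
    · simp only [Idx.par, mul_one, superSign_one]
      rw [pd_inr_bas, pd_inr_bas]
      by_cases hk : k ∈ v <;> by_cases hl : l ∈ v <;>
        simp only [hk, hl, if_true, if_false, map_zero, map_smul, pd_inr_bas, Finset.mem_erase,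
          and_true, and_false, smul_zero, ne_eq]
      rcases eq_or_ne k l with rfl | hkl
      · simp
      · rw [if_pos hkl, if_pos hkl.symm, smul_smul, smul_smul, smul_smul, Finset.erase_right_comm,
          ← pow_add, mul_assoc, ← pow_add, neg_one_mul, ← neg_one_pow_succ]
        congr 1
        apply neg_one_pow_eq_of_mod_two
        have h1 := inversions_erase_right {k} hl
        have h2 := inversions_erase_right {l} hk
        have h3 := inversions_add_swap (u := {k}) (v := {l}) (by simpa using hkl)
        simp only [Finset.card_singleton, mul_one] at h3
        omega

theorem mulO_comm_bas_left (a : Mon m n) (b : Mon m n) (f : O F m n) :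
    bas F m n a ⋆ (bas F m n b ⋆ f)
      = superSign F ((a.2.card : ZMod 2) * b.2.card) • (bas F m n b ⋆ (bas F m n a ⋆ f)) := by
  rw [← mulO_assoc, mulO_comm_bas, map_smul, LinearMap.smul_apply, mulO_assoc]

/-! ### The value at the origin -/

/-- The constant term. -/
noncomputable def constTerm (F : Type*) [CommRing F] (m n : ℕ) : O F m n →ₗ[F] F :=
  (bas F m n).coord (0, ∅)

theorem constTerm_bas (a : Mon m n) :
    constTerm F m n (bas F m n a) = if a = (0, ∅) then 1 else 0 := by
  rw [constTerm, Module.Basis.coord_apply, Module.Basis.repr_self, Finsupp.single_apply]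

theorem constTerm_mulO (f g : O F m n) :
    constTerm F m n (f ⋆ g) = constTerm F m n f * constTerm F m n g := by
  induction f using O.induction with
  | hadd f f' hf hf' => simp only [map_add, LinearMap.add_apply, hf, hf', add_mul]
  | hsmul c f hf => simp only [map_smul, LinearMap.smul_apply, hf, smul_eq_mul, mul_assoc]
  | hb a =>
    induction g using O.induction with
    | hadd f f' hf hf' => simp only [map_add, hf, hf', mul_add]
    | hsmul c f hf => simp only [map_smul, hf, smul_eq_mul]; ring
    | hb b =>
      by_cases ha : a = (0, ∅)
      · rw [ha, one_mulO, constTerm_bas (0, ∅), if_pos rfl, one_mul]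
      · rw [constTerm_bas a, if_neg ha, zero_mul]
        by_cases hab : Disjoint a.2 b.2
        · rw [mulO_bas_of_disjoint hab, map_smul, constTerm_bas, if_neg, smul_zero]
          intro h
          rw [Prod.mk.injEq] at h
          refine ha (Prod.ext ?_ ?_)
          · funext i
            have := congrFun h.1 i
            simp at this
            simpa using this.1
          · exact (Finset.union_eq_empty.1 h.2).1
        · rw [mulO_bas_of_not_disjoint hab, map_zero]

/-- An element with zero derivatives is constant. -/
theorem eq_constTerm_of_pd_eq_zero {f : O F m n} (hf : ∀ i, pd F m n i f = 0) :
    f = constTerm F m n f • bas F m n (0, ∅) := by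
  -- A coefficient of `f` at `a ≠ 0` shows up, up to sign, in some `∂_i f`.
  refine (bas F m n).ext_elem fun a => ?_
  rw [map_smul, Module.Basis.repr_self, Finsupp.smul_single, smul_eq_mul, mul_one,
    Finsupp.single_apply]
  split_ifs with ha
  · rw [← ha]; rfl
  by_cases ha1 : a.1 = 0
  · obtain ⟨k, hk⟩ : a.2.Nonempty := by
      rw [Finset.nonempty_iff_ne_empty]
      exact fun h => ha (Prod.ext ha1.symm h.symm)
    have key : (bas F m n).coord (a.1, a.2.erase k) ∘ₗ pd F m n (Sum.inr k)
        = ((-1 : F) ^ inversions {k} a.2) • (bas F m n).coord a := by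
      refine (bas F m n).ext fun b => ?_
      simp only [LinearMap.comp_apply, LinearMap.smul_apply, Module.Basis.coord_apply, pd_inr_bas,
        Module.Basis.repr_self]
      by_cases hb : k ∈ b.2
      · rw [if_pos hb, map_smul, Module.Basis.repr_self, Finsupp.smul_apply, Finsupp.single_apply,
          Finsupp.single_apply]
        by_cases hba : b = a
        · simp [hba]
        · rw [if_neg hba, if_neg, smul_zero, smul_zero]
          intro h
          rw [Prod.mk.injEq] at h
          refine hba (Prod.ext h.1 ?_)
          rw [← Finset.insert_erase hb, h.2, Finset.insert_erase hk]
      · rw [if_neg hb, map_zero, Finsupp.zero_apply, Finsupp.single_apply, if_neg, smul_zero]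
        rintro rfl
        exact hb hk
    have h := LinearMap.congr_fun key f
    rw [LinearMap.comp_apply, hf, map_zero, LinearMap.smul_apply] at h
    have h1 : (-1 : F) ^ inversions {k} a.2 * (-1 : F) ^ inversions {k} a.2 = 1 := by
      rw [← mul_pow]; simp
    calc _ = ((-1 : F) ^ inversions {k} a.2 * (-1 : F) ^ inversions {k} a.2)
          • (bas F m n).coord a f := by rw [h1, one_smul]; rfl
      _ = 0 := by rw [mul_smul, ← h, smul_zero]
  · obtain ⟨i, hi⟩ : ∃ i, a.1 i ≠ 0 := by
      by_contra! h
      exact ha1 (funext h)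
    have key : (bas F m n).coord (a.1 - Pi.single i 1, a.2) ∘ₗ pd F m n (Sum.inl i)
        = (bas F m n).coord a := by
      refine (bas F m n).ext fun b => ?_
      simp only [LinearMap.comp_apply, Module.Basis.coord_apply, pd_inl_bas,
        Module.Basis.repr_self]
      by_cases hb : b.1 i = 0
      · rw [if_pos hb, map_zero, Finsupp.zero_apply, Finsupp.single_apply, if_neg]
        rintro rfl
        exact hi hb
      · rw [if_neg hb, Module.Basis.repr_self, Finsupp.single_apply, Finsupp.single_apply]
        by_cases hba : b = a
        · simp [hba]
        · rw [if_neg hba, if_neg]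
          intro h
          rw [Prod.mk.injEq] at h
          refine hba (Prod.ext (funext fun j => ?_) h.2)
          have h3 := congrFun h.1 j
          rcases eq_or_ne j i with rfl | hj
          · simp at h3; omega
          · simpa [hj] using h3
    have h := LinearMap.congr_fun key f
    rw [LinearMap.comp_apply, hf, map_zero] at h
    exact h.symm

end Algebra

end Contact

namespace Contact

section Parity

variable {F : Type*} [CommRing F] {m n : ℕ}

local notation:70 f:70 " ⋆ " g:71 => mulO _ _ _ f g

/-! ### Homogeneous operators and the supercommutator -/

theorem sum_zmod_two {M : Type*} [AddCommMonoid M] (f : ZMod 2 → M) :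
    ∑ a : ZMod 2, f a = f 0 + f 1 :=
  Fin.sum_univ_two f

theorem bas_mem_parO (a : Mon m n) : bas F m n a ∈ parO F m n (a.2.card : ZMod 2) :=
  Submodule.subset_span ⟨a, rfl, rfl⟩

theorem projO_bas (γ : ZMod 2) (a : Mon m n) :
    projO F m n γ (bas F m n a) = if (a.2.card : ZMod 2) = γ then bas F m n a else 0 := by
  simp [projO]

theorem projO_of_mem {γ : ZMod 2} {f : O F m n} (hf : f ∈ parO F m n γ) (γ' : ZMod 2) :
    projO F m n γ' f = if γ = γ' then f else 0 := by
  induction hf using Submodule.span_induction with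
  | mem x hx =>
    obtain ⟨a, ha, rfl⟩ := hx
    rw [projO_bas, show (a.2.card : ZMod 2) = γ from ha]
  | zero => simp
  | add x y _ _ hx hy => rw [map_add, hx, hy]; split_ifs <;> simp
  | smul c x _ hx => rw [map_smul, hx]; split_ifs <;> simp

theorem projO_mem (γ : ZMod 2) (f : O F m n) : projO F m n γ f ∈ parO F m n γ := by
  induction f using O.induction with
  | hadd f g hf hg => rw [map_add]; exact Submodule.add_mem _ hf hg
  | hsmul c f hf => rw [map_smul]; exact Submodule.smul_mem _ _ hf
  | hb a =>
    rw [projO_bas]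
    split_ifs with h
    · exact h ▸ bas_mem_parO a
    · exact Submodule.zero_mem _

theorem projO_zero_add_one (f : O F m n) : projO F m n 0 f + projO F m n 1 f = f := by
  induction f using O.induction with
  | hadd f g hf hg => rw [map_add, map_add, add_add_add_comm, hf, hg]
  | hsmul c f hf => rw [map_smul, map_smul, ← smul_add, hf]
  | hb a =>
    rw [projO_bas, projO_bas]
    rcases ZMod.two_cases (a.2.card : ZMod 2) with h | h <;> simp [h]

theorem partEnd_apply (γ : ZMod 2) (D : Module.End F (O F m n)) (f : O F m n) :
    partEnd F m n γ D f
      = projO F m n γ (D (projO F m n 0 f)) + projO F m n (γ + 1) (D (projO F m n 1 f)) := by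
  simp [partEnd, sum_zmod_two]

theorem partEnd_apply_of_mem (γ : ZMod 2) (D : Module.End F (O F m n)) {β : ZMod 2}
    {f : O F m n} (hf : f ∈ parO F m n β) :
    partEnd F m n γ D f = projO F m n (γ + β) (D f) := by
  rw [partEnd_apply, projO_of_mem hf, projO_of_mem hf]
  rcases ZMod.two_cases β with rfl | rfl <;> simp

theorem partEnd_mem (γ : ZMod 2) (D : Module.End F (O F m n)) :
    partEnd F m n γ D ∈ parEnd F m n γ := by
  intro β f hf
  rw [partEnd_apply_of_mem γ D hf]
  exact projO_mem _ _

theorem partEnd_of_mem {γ : ZMod 2} {D : Module.End F (O F m n)} (hD : D ∈ parEnd F m n γ)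
    (γ' : ZMod 2) : partEnd F m n γ' D = if γ = γ' then D else 0 := by
  refine (bas F m n).ext fun a => ?_
  rw [partEnd_apply_of_mem γ' D (bas_mem_parO a), projO_of_mem (hD _ _ (bas_mem_parO a))]
  simp only [add_left_inj]
  split_ifs <;> rfl

theorem partEnd_zero_add_one (D : Module.End F (O F m n)) :
    partEnd F m n 0 D + partEnd F m n 1 D = D := by
  refine (bas F m n).ext fun a => ?_
  rw [LinearMap.add_apply, partEnd_apply_of_mem _ D (bas_mem_parO a),
    partEnd_apply_of_mem _ D (bas_mem_parO a)]
  rcases ZMod.two_cases (a.2.card : ZMod 2) with h | h <;> rw [h]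
  · simpa using projO_zero_add_one (D (bas F m n a))
  · simpa [add_comm, CharTwo.add_self_eq_zero] using projO_zero_add_one (D (bas F m n a))

theorem mem_parEnd_iff {γ : ZMod 2} {D : Module.End F (O F m n)} :
    D ∈ parEnd F m n γ ↔ ∀ a, D (bas F m n a) ∈ parO F m n (γ + a.2.card) := by
  refine ⟨fun hD a => hD _ _ (bas_mem_parO a), fun h β f hf => ?_⟩
  induction hf using Submodule.span_induction with
  | mem x hx => obtain ⟨a, rfl, rfl⟩ := hx; exact h a
  | zero => rw [map_zero]; exact Submodule.zero_mem _
  | add x y _ _ hx hy => rw [map_add]; exact Submodule.add_mem _ hx hy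
  | smul c x _ hx => rw [map_smul]; exact Submodule.smul_mem _ _ hx

theorem mul_mem_parEnd {a b : ZMod 2} {D E : Module.End F (O F m n)}
    (hD : D ∈ parEnd F m n a) (hE : E ∈ parEnd F m n b) : D * E ∈ parEnd F m n (a + b) := by
  intro β f hf
  rw [add_assoc]
  exact hD _ _ (hE _ _ hf)

theorem superComm_of_mem {a b : ZMod 2} {D E : Module.End F (O F m n)}
    (hD : D ∈ parEnd F m n a) (hE : E ∈ parEnd F m n b) :
    superComm F m n D E = D * E - superSign F (a * b) • (E * D) := by
  simp only [superComm, sum_zmod_two, LinearMap.add_apply, LinearMap.sub_apply,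
    LinearMap.smul_apply, LinearMap.compl₁₂_apply, LinearMap.mul_apply', LinearMap.flip_apply,
    partEnd_of_mem hD, partEnd_of_mem hE]
  rcases ZMod.two_cases a with rfl | rfl <;> rcases ZMod.two_cases b with rfl | rfl <;> simp

theorem superComm_of_even {D : Module.End F (O F m n)} (hD : D ∈ parEnd F m n 0)
    (E : Module.End F (O F m n)) : superComm F m n D E = D * E - E * D := by
  conv_lhs => rw [← partEnd_zero_add_one E]
  rw [map_add, superComm_of_mem hD (partEnd_mem 0 E), superComm_of_mem hD (partEnd_mem 1 E)]
  conv_rhs => rw [← partEnd_zero_add_one E]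
  rw [zero_mul, zero_mul, superSign_zero, one_smul, one_smul, mul_add, add_mul]
  abel

theorem superComm_mem_parEnd {a b : ZMod 2} {D E : Module.End F (O F m n)}
    (hD : D ∈ parEnd F m n a) (hE : E ∈ parEnd F m n b) :
    superComm F m n D E ∈ parEnd F m n (a + b) := by
  rw [superComm_of_mem hD hE]
  refine Submodule.sub_mem _ (mul_mem_parEnd hD hE) (Submodule.smul_mem _ _ ?_)
  rw [add_comm]
  exact mul_mem_parEnd hE hD

theorem superComm_skew {a b : ZMod 2} {D E : Module.End F (O F m n)}
    (hD : D ∈ parEnd F m n a) (hE : E ∈ parEnd F m n b) :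
    superComm F m n D E = -(superSign F (a * b) • superComm F m n E D) := by
  rw [superComm_of_mem hD hE, superComm_of_mem hE hD]
  rcases ZMod.two_cases a with rfl | rfl <;> rcases ZMod.two_cases b with rfl | rfl <;> simp

theorem superComm_jacobi {a b c : ZMod 2} {D E G : Module.End F (O F m n)}
    (hD : D ∈ parEnd F m n a) (hE : E ∈ parEnd F m n b) (hG : G ∈ parEnd F m n c) :
    superComm F m n D (superComm F m n E G)
      = superComm F m n (superComm F m n D E) G
        + superSign F (a * b) • superComm F m n E (superComm F m n D G) := by
  rw [superComm_of_mem hD (superComm_mem_parEnd hE hG),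
    superComm_of_mem (superComm_mem_parEnd hD hE) hG,
    superComm_of_mem hE (superComm_mem_parEnd hD hG), superComm_of_mem hE hG,
    superComm_of_mem hD hE, superComm_of_mem hD hG]
  rcases ZMod.two_cases a with rfl | rfl <;> rcases ZMod.two_cases b with rfl | rfl <;>
    rcases ZMod.two_cases c with rfl | rfl <;>
    simp only [mul_zero, mul_one, superSign_zero, superSign_one, one_smul, neg_one_smul,
      add_zero, zero_add, mul_sub, sub_mul, mul_add, add_mul, sub_neg_eq_add, mul_assoc,
      CharTwo.add_self_eq_zero] <;> abel

/-- The homogeneous parts of a supercommutator. -/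
theorem partEnd_superComm (γ : ZMod 2) (D E : Module.End F (O F m n)) :
    partEnd F m n γ (superComm F m n D E)
      = superComm F m n (partEnd F m n 0 D) (partEnd F m n γ E)
        + superComm F m n (partEnd F m n 1 D) (partEnd F m n (γ + 1) E) := by
  have h (a b : ZMod 2) : partEnd F m n γ (superComm F m n (partEnd F m n a D)
      (partEnd F m n b E)) = if a + b = γ then
        superComm F m n (partEnd F m n a D) (partEnd F m n b E) else 0 :=
    partEnd_of_mem (superComm_mem_parEnd (partEnd_mem a D) (partEnd_mem b E)) γ
  conv_lhs => rw [← partEnd_zero_add_one D, ← partEnd_zero_add_one E]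
  simp only [map_add, LinearMap.add_apply, h]
  rcases ZMod.two_cases γ with rfl | rfl <;> simp [CharTwo.add_self_eq_zero, add_comm]

/-! ### Vector fields -/

theorem field_apply (i : Idx m n) (f g : O F m n) :
    field F m n i f g = f ⋆ pd F m n i g := rfl

theorem pd_mem_parEnd (i : Idx m n) : pd F m n i ∈ parEnd F m n i.par := by
  rw [mem_parEnd_iff]
  intro a
  rcases i with i | k
  · rw [pd_inl_bas]
    split_ifs
    · exact Submodule.zero_mem _
    · rw [Idx.par, zero_add]
      exact bas_mem_parO (F := F) (a.1 - Pi.single i 1, a.2)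
  · rw [pd_inr_bas]
    split_ifs with hk
    · refine Submodule.smul_mem _ _ ?_
      have h := bas_mem_parO (F := F) (m := m) (a.1, a.2.erase k)
      rw [Idx.par, ← Finset.card_erase_add_one hk, Nat.cast_add, Nat.cast_one, add_left_comm,
        CharTwo.add_self_eq_zero, add_zero]
      exact h
    · exact Submodule.zero_mem _

theorem mulO_bas_mem_parEnd (a : Mon m n) :
    mulO F m n (bas F m n a) ∈ parEnd F m n (a.2.card : ZMod 2) := by
  rw [mem_parEnd_iff]
  intro b
  by_cases hab : Disjoint a.2 b.2
  · rw [mulO_bas_of_disjoint hab]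
    refine Submodule.smul_mem _ _ ?_
    have h := bas_mem_parO (F := F) (a.1 + b.1, a.2 ∪ b.2)
    rwa [Finset.card_union_of_disjoint hab, Nat.cast_add] at h
  · rw [mulO_bas_of_not_disjoint hab]
    exact Submodule.zero_mem _

theorem mulO_mem_parEnd {γ : ZMod 2} {f : O F m n} (hf : f ∈ parO F m n γ) :
    mulO F m n f ∈ parEnd F m n γ := by
  induction hf using Submodule.span_induction with
  | mem x hx => obtain ⟨a, rfl, rfl⟩ := hx; exact mulO_bas_mem_parEnd a
  | zero => rw [map_zero]; exact Submodule.zero_mem _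
  | add x y _ _ hx hy => rw [map_add]; exact Submodule.add_mem _ hx hy
  | smul c x _ hx => rw [map_smul]; exact Submodule.smul_mem _ _ hx

theorem field_mem_parEnd (i : Idx m n) {γ : ZMod 2} {f : O F m n} (hf : f ∈ parO F m n γ) :
    field F m n i f ∈ parEnd F m n (γ + i.par) :=
  mul_mem_parEnd (mulO_mem_parEnd hf) (pd_mem_parEnd i)

/-- `W(m,n)`, spanned by the vector fields `f ∂_i`. -/
noncomputable def vectorFields (F : Type*) [CommRing F] (m n : ℕ) :
    Submodule F (Module.End F (O F m n)) :=
  Submodule.span F (Set.range fun q : Idx m n × Mon m n => field F m n q.1 (bas F m n q.2))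

theorem field_mem_vectorFields (i : Idx m n) (f : O F m n) :
    field F m n i f ∈ vectorFields F m n := by
  induction f using O.induction with
  | hadd f g hf hg => rw [map_add]; exact Submodule.add_mem _ hf hg
  | hsmul c f hf => rw [map_smul]; exact Submodule.smul_mem _ _ hf
  | hb a => exact Submodule.subset_span ⟨(i, a), rfl⟩

theorem field_mul_field (i j : Idx m n) (a b : Mon m n) (f : O F m n) :
    field F m n i (bas F m n a) (field F m n j (bas F m n b) f)
      = field F m n j (bas F m n a ⋆ pd F m n i (bas F m n b)) f
        + superSign F (i.par * b.2.card) •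
          (bas F m n a ⋆ (bas F m n b ⋆ pd F m n i (pd F m n j f))) := by
  simp only [field_apply]
  rw [pd_mulO_bas, map_add, map_smul, mulO_assoc]

/-- The supercommutator of two vector fields is a vector field: the second order terms cancel. -/
theorem superComm_mem_vectorFields {D E : Module.End F (O F m n)}
    (hD : D ∈ vectorFields F m n) (hE : E ∈ vectorFields F m n) :
    superComm F m n D E ∈ vectorFields F m n := by
  induction hD using Submodule.span_induction with
  | zero => rw [map_zero]; exact Submodule.zero_mem _
  | add x y _ _ hx hy => rw [map_add]; exact Submodule.add_mem _ hx hy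
  | smul c x _ hx => rw [map_smul]; exact Submodule.smul_mem _ _ hx
  | mem x hx =>
    obtain ⟨⟨i, a⟩, rfl⟩ := hx
    induction hE using Submodule.span_induction with
    | zero => rw [map_zero]; exact Submodule.zero_mem _
    | add x y _ _ hx hy => rw [map_add]; exact Submodule.add_mem _ hx hy
    | smul c x _ hx => rw [map_smul]; exact Submodule.smul_mem _ _ hx
    | mem x hx =>
      obtain ⟨⟨j, b⟩, rfl⟩ := hx
      have key : superComm F m n (field F m n i (bas F m n a)) (field F m n j (bas F m n b))
          = field F m n j (bas F m n a ⋆ pd F m n i (bas F m n b))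
            - superSign F ((a.2.card + i.par) * (b.2.card + j.par)) •
              field F m n i (bas F m n b ⋆ pd F m n j (bas F m n a)) := by
        rw [superComm_of_mem (field_mem_parEnd i (bas_mem_parO a))
          (field_mem_parEnd j (bas_mem_parO b))]
        refine LinearMap.ext fun f => ?_
        simp only [LinearMap.sub_apply, LinearMap.smul_apply, Module.End.mul_apply]
        rw [field_mul_field, field_mul_field, pd_pd_comm i j, mulO_comm_bas_left a b]
        rcases ZMod.two_cases (a.2.card : ZMod 2) with ha | ha <;>
          rcases ZMod.two_cases (b.2.card : ZMod 2) with hb | hb <;>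
          rcases ZMod.two_cases i.par with hi | hi <;>
          rcases ZMod.two_cases j.par with hj | hj <;>
          simp [ha, hb, hi, hj, CharTwo.add_self_eq_zero]
      rw [key]
      exact Submodule.sub_mem _ (field_mem_vectorFields _ _)
        (Submodule.smul_mem _ _ (field_mem_vectorFields _ _))

theorem pd_var (i j : Idx m n) :
    pd F m n i (var F m n j) = if i = j then bas F m n (0, ∅) else 0 := by
  rcases i with i | k <;> rcases j with j | l
  · rw [var, pd_inl_bas]
    rcases eq_or_ne i j with rfl | hij
    · simp
    · simp [hij]
  · simp [var, pd_inl_bas]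
  · simp [var, pd_inr_bas]
  · rw [var, pd_inr_bas]
    rcases eq_or_ne k l with rfl | hkl
    · simp [inversions, Finset.filter_singleton]
    · simp [hkl]

/-- A vector field is determined by its values on the variables. -/
theorem apply_of_mem_vectorFields {D : Module.End F (O F m n)} (hD : D ∈ vectorFields F m n)
    (f : O F m n) : D f = ∑ i, D (var F m n i) ⋆ pd F m n i f := by
  induction hD using Submodule.span_induction with
  | mem x hx =>
    obtain ⟨⟨i, a⟩, rfl⟩ := hx
    simp only [field_apply, pd_var]
    rw [Finset.sum_eq_single i]
    · rw [if_pos rfl, mulO_one]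
    · intro j _ hj
      rw [if_neg hj.symm, map_zero, map_zero, LinearMap.zero_apply]
    · simp
  | zero => simp
  | add x y _ _ hx hy => simp only [LinearMap.add_apply, hx, hy, map_add, Finset.sum_add_distrib]
  | smul c x _ hx => simp only [LinearMap.smul_apply, hx, map_smul, Finset.smul_sum]

theorem apply_one_of_mem_vectorFields {D : Module.End F (O F m n)}
    (hD : D ∈ vectorFields F m n) : D (bas F m n (0, ∅)) = 0 := by
  rw [apply_of_mem_vectorFields hD]
  refine Finset.sum_eq_zero fun i _ => ?_
  rcases i with i | k
  · simp [pd_inl_bas]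
  · simp [pd_inr_bas]

end Parity

end Contact

namespace Contact

section ContactFields

variable {F : Type*} [CommRing F] {r h : ℕ}

local notation:70 f:70 " ⋆ " g:71 => mulO _ _ _ f g

/-! ### Contact vector fields -/

theorem conj_conj (k : ℕ) (i : Fin (2 * k)) : Contact.conj k (Contact.conj k i) = i := by
  ext
  unfold Contact.conj
  split_ifs with h1 h2 h2 <;> simp only at h2 ⊢ <;> omega

theorem J.conj_conj (i : J r h) : i.conj.conj = i := by
  rcases i with i | k <;> simp [J.conj, Contact.conj_conj]

theorem J.toIdx_injective : Function.Injective (J.toIdx (r := r) (h := h)) := by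
  rintro (i | k) (j | l) hij <;> simp_all [J.toIdx]

theorem J.toIdx_ne_idxM (i : J r h) : i.toIdx ≠ idxM r h := by
  rcases i with i | k
  · simp [J.toIdx, idxM, (Fin.castSucc_lt_last i).ne]
  · simp [J.toIdx, idxM]

theorem idx_cases (i : Idx (2 * r + 1) (2 * h)) : i = idxM r h ∨ ∃ j : J r h, i = j.toIdx := by
  rcases i with i | k
  · induction i using Fin.lastCases with
    | last => exact Or.inl rfl
    | cast i => exact Or.inr ⟨Sum.inl i, rfl⟩
  · exact Or.inr ⟨Sum.inr k, rfl⟩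

theorem sum_idx {M : Type*} [AddCommMonoid M] (f : Idx (2 * r + 1) (2 * h) → M) :
    ∑ i, f i = ∑ j : J r h, f j.toIdx + f (idxM r h) := by
  rw [Fintype.sum_sum_type, Fin.sum_univ_castSucc, Fintype.sum_sum_type]
  simp only [J.toIdx, idxM]
  abel

theorem J.par_conj (i : J r h) : i.conj.toIdx.par = i.toIdx.par := by
  rcases i with i | k <;> rfl

theorem J.sigma_mul_self (i : J r h) : i.sigma F * i.sigma F = 1 := by
  rcases i with i | k
  · rw [J.sigma]; split_ifs <;> simp
  · simp [J.sigma]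

theorem var_mem_parO {m n : ℕ} (i : Idx m n) : var F m n i ∈ parO F m n i.par := by
  rcases i with i | k
  · simpa [var, Idx.par] using bas_mem_parO (F := F) (Pi.single i 1, (∅ : Finset (Fin n)))
  · simpa [var, Idx.par] using bas_mem_parO (F := F) ((0 : Fin m → ℕ), ({k} : Finset (Fin n)))

theorem one_mem_parO {m n : ℕ} : bas F m n (0, ∅) ∈ parO F m n 0 := by
  simpa using bas_mem_parO (F := F) ((0 : Fin m → ℕ), (∅ : Finset (Fin n)))

theorem twist_of_mem {m n : ℕ} (i : Idx m n) {γ : ZMod 2} {f : O F m n}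
    (hf : f ∈ parO F m n γ) : twist F m n i f = superSign F (i.par * γ) • f := by
  rcases i with i | k
  · simp [twist, Idx.par]
  · rcases ZMod.two_cases γ with rfl | rfl <;>
      simp [twist, Idx.par, sum_zmod_two, projO_of_mem hf]

theorem DK_apply (f : O F (2 * r + 1) (2 * h)) :
    DK F r h f = ∑ i : J r h, field F _ _ i.toIdx
        (var F _ _ i.toIdx ⋆ pd F _ _ (idxM r h) (twist F _ _ i.toIdx f)
          + i.conj.sigma F • pd F _ _ i.conj.toIdx (twist F _ _ i.toIdx f))
      + field F _ _ (idxM r h)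
        ((2 : F) • f - ∑ i : J r h, var F _ _ i.toIdx ⋆ pd F _ _ i.toIdx f) := by
  simp only [DK, LinearMap.add_apply, LinearMap.sum_apply, LinearMap.comp_apply,
    LinearMap.smul_apply, LinearMap.sub_apply, LinearMap.id_apply]

theorem DK_mem_vectorFields (f : O F (2 * r + 1) (2 * h)) :
    DK F r h f ∈ vectorFields F _ _ := by
  rw [DK_apply]
  exact Submodule.add_mem _ (Submodule.sum_mem _ fun i _ => field_mem_vectorFields _ _)
    (field_mem_vectorFields _ _)

theorem pd_mem_parO {m n : ℕ} (i : Idx m n) {γ : ZMod 2} {f : O F m n} (hf : f ∈ parO F m n γ) :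
    pd F m n i f ∈ parO F m n (i.par + γ) :=
  pd_mem_parEnd i _ _ hf

theorem mulO_mem_parO {m n : ℕ} {α β : ZMod 2} {f g : O F m n} (hf : f ∈ parO F m n α)
    (hg : g ∈ parO F m n β) : f ⋆ g ∈ parO F m n (α + β) :=
  mulO_mem_parEnd hf _ _ hg

/-- `D_K` preserves parity. -/
theorem DK_mem_parEnd {γ : ZMod 2} {f : O F (2 * r + 1) (2 * h)} (hf : f ∈ parO F _ _ γ) :
    DK F r h f ∈ parEnd F _ _ γ := by
  have hs (k l : ZMod 2) : k + l + l = k := by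
    rw [add_assoc, CharTwo.add_self_eq_zero, add_zero]
  have hs' (k l : ZMod 2) : l + (l + k) = k := by
    rw [← add_assoc, CharTwo.add_self_eq_zero, zero_add]
  rw [DK_apply]
  refine Submodule.add_mem _ (Submodule.sum_mem _ fun i _ => ?_) ?_
  · rw [twist_of_mem _ hf]
    have h0 : pd F _ _ (idxM r h) f ∈ parO F _ _ γ := zero_add γ ▸ pd_mem_parO (idxM r h) hf
    have h1 : var F _ _ i.toIdx ⋆ pd F _ _ (idxM r h) f ∈ parO F _ _ (γ + i.toIdx.par) :=
      (add_comm i.toIdx.par γ) ▸ mulO_mem_parO (var_mem_parO i.toIdx) h0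
    have h2 : pd F _ _ i.conj.toIdx f ∈ parO F _ _ (γ + i.toIdx.par) :=
      (add_comm i.toIdx.par γ) ▸ (J.par_conj i) ▸ pd_mem_parO i.conj.toIdx hf
    have h3 := field_mem_parEnd i.toIdx (Submodule.smul_mem _ (superSign F (i.toIdx.par * γ))
      (Submodule.add_mem _ h1 (Submodule.smul_mem _ (i.conj.sigma F) h2)))
    rw [hs, smul_add, smul_comm] at h3
    simpa only [map_smul] using h3
  · have h1 : ∑ i : J r h, var F _ _ i.toIdx ⋆ pd F _ _ i.toIdx f ∈ parO F _ _ γ :=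
      Submodule.sum_mem _ fun i _ =>
        hs' γ i.toIdx.par ▸ mulO_mem_parO (var_mem_parO i.toIdx) (pd_mem_parO i.toIdx hf)
    exact add_zero γ ▸ field_mem_parEnd (idxM r h)
      (Submodule.sub_mem _ (Submodule.smul_mem _ (2 : F) hf) h1)

theorem pd_one {m n : ℕ} (i : Idx m n) : pd F m n i (bas F m n (0, ∅)) = 0 := by
  rcases i with i | k
  · simp [pd_inl_bas]
  · simp [pd_inr_bas]

theorem field_one {m n : ℕ} (i : Idx m n) : field F m n i (bas F m n (0, ∅)) = pd F m n i :=
  LinearMap.ext fun f => by rw [field_apply, one_mulO]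

theorem DK_one : DK F r h (bas F _ _ (0, ∅)) = (2 : F) • pd F _ _ (idxM r h) := by
  rw [DK_apply]
  simp only [twist_of_mem _ one_mem_parO, map_smul, pd_one, smul_zero, map_zero, add_zero,
    Finset.sum_const_zero, zero_add, sub_zero, field_one]

theorem DK_var_idxM : DK F r h (var F _ _ (idxM r h))
    = ∑ i : J r h, field F _ _ i.toIdx (var F _ _ i.toIdx)
      + (2 : F) • field F _ _ (idxM r h) (var F _ _ (idxM r h)) := by
  rw [DK_apply]
  congr 1
  · refine Finset.sum_congr rfl fun i _ => ?_
    rw [twist_of_mem _ (var_mem_parO _), show (idxM r h).par = 0 from rfl, mul_zero,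
      superSign_zero, one_smul, pd_var, if_pos rfl, pd_var, if_neg (J.toIdx_ne_idxM _), smul_zero,
      add_zero, mulO_one]
  · rw [Finset.sum_eq_zero, sub_zero, map_smul]
    intro i _
    rw [pd_var, if_neg (J.toIdx_ne_idxM _), map_zero]

theorem DK_var (i : J r h) : DK F r h (var F _ _ i.toIdx)
    = (superSign F i.toIdx.par * i.sigma F) • pd F _ _ i.conj.toIdx
      + field F _ _ (idxM r h) (var F _ _ i.toIdx) := by
  rw [DK_apply]
  congr 1
  · rw [Finset.sum_eq_single i.conj]
    · rw [twist_of_mem _ (var_mem_parO _), J.par_conj, J.conj_conj]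
      simp only [map_smul, pd_var, if_neg (J.toIdx_ne_idxM i).symm, if_true, smul_zero, map_zero,
        zero_add, field_one, smul_smul]
      rw [mul_comm (J.sigma F i)]
      rcases ZMod.two_cases i.toIdx.par with hi | hi <;> simp [hi]
    · intro j _ hj
      have hji : j.conj.toIdx ≠ i.toIdx := fun h1 => hj (by
        rw [← J.toIdx_injective h1, J.conj_conj])
      rw [twist_of_mem _ (var_mem_parO _)]
      simp only [map_smul, pd_var, if_neg (J.toIdx_ne_idxM i).symm, if_neg hji, smul_zero,
        map_zero, add_zero]
    · simp
  · congr 1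
    rw [Finset.sum_eq_single i, pd_var, if_pos rfl, mulO_one, two_smul, add_sub_cancel_right]
    · intro j _ hj
      rw [pd_var, if_neg (fun h1 => hj (J.toIdx_injective h1)), map_zero]
    · simp

theorem DK_var_apply (i : J r h) (f : O F (2 * r + 1) (2 * h)) : DK F r h (var F _ _ i.toIdx) f
    = (superSign F i.toIdx.par * i.sigma F) • pd F _ _ i.conj.toIdx f
      + var F _ _ i.toIdx ⋆ pd F _ _ (idxM r h) f := by
  rw [DK_var]; rfl

/-! ### The weighted degree, in which the variable `x_m` has degree `2` -/

/-- The weight of a variable: `2` for `x_m`, and `1` for the others. -/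
def weight (i : Idx (2 * r + 1) (2 * h)) : ℕ := if i = idxM r h then 2 else 1

/-- The exponent of a variable in a monomial. -/
def exponent {m n : ℕ} (a : Mon m n) : Idx m n → ℕ
  | Sum.inl i => a.1 i
  | Sum.inr k => if k ∈ a.2 then 1 else 0

/-- The weighted degree of a monomial. -/
def weightedDegree (a : Mon (2 * r + 1) (2 * h)) : ℕ := ∑ i, weight i * exponent a i

theorem var_mulO_pd_bas {m n : ℕ} (i : Idx m n) (a : Mon m n) :
    var F m n i ⋆ pd F m n i (bas F m n a) = (exponent a i : F) • bas F m n a := by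
  rcases i with i | k
  · rw [pd_inl_bas, var, exponent]
    split_ifs with hi
    · simp [hi]
    · rw [mulO_bas_of_disjoint (by simp)]
      have h1 : (Pi.single i 1 : Fin m → ℕ) + (a.1 - Pi.single i 1) = a.1 := by
        ext j
        rcases eq_or_ne j i with rfl | hj
        · simp; omega
        · simp [hj]
      simp only [divCoeff_single, h1, Finset.empty_union, inversions_empty_left, pow_zero, mul_one]
      congr 2
      simp
      omega
  · rw [pd_inr_bas, var, exponent]
    split_ifs with hk
    · have h1 := inversions_erase_right {k} hk
      have h2 : inversions ({k} : Finset (Fin n)) {k} = 0 := by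
        simp [inversions, Finset.filter_singleton]
      rw [h2, zero_add] at h1
      rw [map_smul, mulO_bas_of_disjoint (by simp), smul_smul]
      simp only [divCoeff_zero_left, one_mul, zero_add, Finset.singleton_union,
        Finset.insert_erase hk, h1, Nat.cast_one]
      rw [← mul_pow]
      simp
    · simp

/-- The operator `D_K(x_m)` multiplies each monomial by its weighted degree. -/
theorem DK_var_idxM_bas (a : Mon (2 * r + 1) (2 * h)) :
    DK F r h (var F _ _ (idxM r h)) (bas F _ _ a) = (weightedDegree a : F) • bas F _ _ a := by
  have hw (i : J r h) : weight i.toIdx = 1 := if_neg (J.toIdx_ne_idxM i)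
  have hm : weight (idxM r h) = 2 := if_pos rfl
  rw [DK_var_idxM, weightedDegree, sum_idx]
  simp only [LinearMap.add_apply, LinearMap.sum_apply, LinearMap.smul_apply, field_apply,
    var_mulO_pd_bas, hw, hm, one_mul]
  push_cast
  rw [add_smul, Finset.sum_smul, mul_smul]

theorem exponent_mul {m n : ℕ} {a b : Mon m n} (hab : Disjoint a.2 b.2) (i : Idx m n) :
    exponent (a.1 + b.1, a.2 ∪ b.2) i = exponent a i + exponent b i := by
  rcases i with i | k
  · rfl
  · simp only [exponent, Finset.mem_union]
    by_cases ha : k ∈ a.2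
    · simp [ha, Finset.disjoint_left.1 hab ha]
    · simp [ha]

theorem weightedDegree_mul {a b : Mon (2 * r + 1) (2 * h)} (hab : Disjoint a.2 b.2) :
    weightedDegree (a.1 + b.1, a.2 ∪ b.2) = weightedDegree a + weightedDegree b := by
  simp only [weightedDegree, exponent_mul hab, mul_add, Finset.sum_add_distrib]

theorem DK_var_idxM_mulO (f g : O F (2 * r + 1) (2 * h)) :
    DK F r h (var F _ _ (idxM r h)) (f ⋆ g)
      = DK F r h (var F _ _ (idxM r h)) f ⋆ g + f ⋆ DK F r h (var F _ _ (idxM r h)) g := by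
  induction f using O.induction with
  | hadd f f' hf hf' => simp only [map_add, LinearMap.add_apply, hf, hf']; abel
  | hsmul c f hf => simp only [map_smul, LinearMap.smul_apply, hf, smul_add]
  | hb a =>
    induction g using O.induction with
    | hadd f f' hf hf' => simp only [map_add, hf, hf']; abel
    | hsmul c f hf => simp only [map_smul, hf, smul_add]
    | hb b =>
      rw [DK_var_idxM_bas, DK_var_idxM_bas]
      by_cases hab : Disjoint a.2 b.2
      · rw [map_smul, map_smul, LinearMap.smul_apply, mulO_bas_of_disjoint hab, map_smul,
          DK_var_idxM_bas, weightedDegree_mul hab, Nat.cast_add, ← add_smul, smul_comm]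
      · simp [mulO_bas_of_not_disjoint hab]

/-- `∂_i` lowers the weighted degree by the weight of `x_i`. -/
theorem pd_bas_cases (i : Idx (2 * r + 1) (2 * h)) (a : Mon (2 * r + 1) (2 * h)) :
    ∃ c : F, ∃ b : Mon (2 * r + 1) (2 * h), pd F _ _ i (bas F _ _ a) = c • bas F _ _ b ∧
      (c = 0 ∨ weightedDegree b + weight i = weightedDegree a) := by
  have key (b : Mon (2 * r + 1) (2 * h))
      (hb : ∀ j, exponent a j = exponent b j + if j = i then 1 else 0) :
      weightedDegree b + weight i = weightedDegree a := by
    simp only [weightedDegree, hb, mul_add, Finset.sum_add_distrib, mul_ite, mul_one, mul_zero,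
      Finset.sum_ite_eq', Finset.mem_univ, if_true]
  rcases i with i | k
  · rw [pd_inl_bas]
    split_ifs with hi
    · exact ⟨0, a, by simp, Or.inl rfl⟩
    · refine ⟨1, _, (one_smul _ _).symm, Or.inr (key _ ?_)⟩
      rintro (j | l)
      · rcases eq_or_ne j i with rfl | hj
        · simp [exponent]; omega
        · simp [exponent, hj]
      · simp [exponent]
  · rw [pd_inr_bas]
    split_ifs with hk
    · refine ⟨_, _, rfl, Or.inr (key _ ?_)⟩
      rintro (j | l)
      · simp [exponent]
      · rcases eq_or_ne l k with rfl | hl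
        · simp [exponent, hk]
        · simp [exponent, hl]
    · exact ⟨0, a, by simp, Or.inl rfl⟩

theorem DK_var_idxM_pd (i : Idx (2 * r + 1) (2 * h)) (f : O F (2 * r + 1) (2 * h)) :
    DK F r h (var F _ _ (idxM r h)) (pd F _ _ i f)
      = pd F _ _ i (DK F r h (var F _ _ (idxM r h)) f) - (weight i : F) • pd F _ _ i f := by
  induction f using O.induction with
  | hadd f f' hf hf' => simp only [map_add, smul_add, hf, hf']; abel
  | hsmul c f hf => simp only [map_smul, hf, smul_sub, smul_comm c]
  | hb a =>
    obtain ⟨c, b, hb, hc⟩ := pd_bas_cases (F := F) i a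
    rw [DK_var_idxM_bas, map_smul, hb, map_smul, DK_var_idxM_bas]
    rcases hc with rfl | hc
    · simp
    · rw [← hc, Nat.cast_add, add_smul, add_sub_cancel_right, smul_comm]

theorem twist_comm {m n : ℕ} {A : Module.End F (O F m n)} (hA : A ∈ parEnd F m n 0)
    (i : Idx m n) (f : O F m n) : A (twist F m n i f) = twist F m n i (A f) := by
  induction f using O.induction with
  | hadd f f' hf hf' => simp only [map_add, hf, hf']
  | hsmul c f hf => simp only [map_smul, hf]
  | hb a =>
    have h1 := hA _ _ (bas_mem_parO a)
    rw [zero_add] at h1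
    rw [twist_of_mem i (bas_mem_parO a), twist_of_mem i h1, map_smul]

/-- The bracket of `D_K(f)` with an even derivation that is diagonal on the variables other than
`x_m` and on the `∂_i`, with compatible weights. It applies to `∂_m` and to `D_K(x_m)`. -/
theorem superComm_DK_of_derivation {A : Module.End F (O F (2 * r + 1) (2 * h))}
    (hA : A ∈ parEnd F _ _ 0) (hmul : ∀ f g, A (f ⋆ g) = A f ⋆ g + f ⋆ A g)
    {c : Idx (2 * r + 1) (2 * h) → F}
    (hpd : ∀ i f, A (pd F _ _ i f) = pd F _ _ i (A f) - c i • pd F _ _ i f)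
    (hvar : ∀ i : J r h, A (var F _ _ i.toIdx) = c i.toIdx • var F _ _ i.toIdx)
    (hc : ∀ i : J r h, c i.toIdx + c i.conj.toIdx = c (idxM r h))
    (f : O F (2 * r + 1) (2 * h)) :
    superComm F _ _ A (DK F r h f) = DK F r h (A f) - c (idxM r h) • DK F r h f := by
  have hfield (i) (g : O F (2 * r + 1) (2 * h)) :
      A * field F _ _ i g - field F _ _ i g * A = field F _ _ i (A g - c i • g) := by
    refine LinearMap.ext fun k => ?_
    simp only [LinearMap.sub_apply, Module.End.mul_apply, field_apply, hmul, hpd, map_sub,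
      map_smul, LinearMap.smul_apply]
    abel
  have hsum {ι : Type} (s : Finset ι) (B : ι → Module.End F (O F (2 * r + 1) (2 * h))) :
      A * (∑ i ∈ s, B i) - (∑ i ∈ s, B i) * A = ∑ i ∈ s, (A * B i - B i * A) := by
    rw [Finset.mul_sum, Finset.sum_mul, Finset.sum_sub_distrib]
  rw [superComm_of_even hA, DK_apply, mul_add, add_mul, add_sub_add_comm, hsum, hfield,
    DK_apply, smul_add, Finset.smul_sum, add_sub_add_comm, ← Finset.sum_sub_distrib]
  congr 1
  · refine Finset.sum_congr rfl fun i _ => ?_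
    have hcoef : A (var F _ _ i.toIdx ⋆ pd F _ _ (idxM r h) (twist F _ _ i.toIdx f)
          + i.conj.sigma F • pd F _ _ i.conj.toIdx (twist F _ _ i.toIdx f))
        - c i.toIdx • (var F _ _ i.toIdx ⋆ pd F _ _ (idxM r h) (twist F _ _ i.toIdx f)
          + i.conj.sigma F • pd F _ _ i.conj.toIdx (twist F _ _ i.toIdx f))
        = (var F _ _ i.toIdx ⋆ pd F _ _ (idxM r h) (twist F _ _ i.toIdx (A f))
          + i.conj.sigma F • pd F _ _ i.conj.toIdx (twist F _ _ i.toIdx (A f)))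
        - c (idxM r h) • (var F _ _ i.toIdx ⋆ pd F _ _ (idxM r h) (twist F _ _ i.toIdx f)
          + i.conj.sigma F • pd F _ _ i.conj.toIdx (twist F _ _ i.toIdx f)) := by
      simp only [map_add, hmul, hvar, hpd, map_smul, twist_comm hA, ← hc i, map_sub,
        LinearMap.smul_apply]
      module
    rw [hfield, hcoef, map_sub, LinearMap.map_smul (field F _ _ i.toIdx)]
  · have hcoef : A ((2 : F) • f - ∑ i : J r h, var F _ _ i.toIdx ⋆ pd F _ _ i.toIdx f)
        = (2 : F) • A f - ∑ i : J r h, var F _ _ i.toIdx ⋆ pd F _ _ i.toIdx (A f) := by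
      rw [map_sub, map_sum, map_smul]
      congr 1
      refine Finset.sum_congr rfl fun i _ => ?_
      rw [hmul, hvar, hpd, map_sub, map_smul, map_smul, LinearMap.smul_apply]
      abel
    rw [hcoef, map_sub, LinearMap.map_smul (field F _ _ (idxM r h))]

theorem DK_one_mem_parEnd : DK F r h (bas F _ _ (0, ∅)) ∈ parEnd F _ _ 0 :=
  DK_mem_parEnd one_mem_parO

theorem DK_var_idxM_mem_parEnd : DK F r h (var F _ _ (idxM r h)) ∈ parEnd F _ _ 0 :=
  DK_mem_parEnd (var_mem_parO (idxM r h))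

theorem superComm_DK_one (f : O F (2 * r + 1) (2 * h)) :
    superComm F _ _ (DK F r h (bas F _ _ (0, ∅))) (DK F r h f)
      = (2 : F) • DK F r h (pd F _ _ (idxM r h) f) := by
  have hm : (idxM r h).par = 0 := rfl
  rw [DK_one, map_smul, LinearMap.smul_apply,
    superComm_DK_of_derivation (c := 0) (pd_mem_parEnd (idxM r h))]
  · simp
  · intro f g
    induction f using O.induction with
    | hadd f f' hf hf' => simp only [map_add, LinearMap.add_apply, hf, hf']; abel
    | hsmul c f hf => simp only [map_smul, LinearMap.smul_apply, hf, smul_add]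
    | hb a => rw [pd_mulO_bas, hm, zero_mul, superSign_zero, one_smul]
  · intro i f
    rw [pd_pd_comm, hm, zero_mul, superSign_zero, one_smul]
    simp
  · intro i
    rw [pd_var, if_neg (J.toIdx_ne_idxM i).symm]
    simp
  · simp

theorem weight_toIdx (i : J r h) : weight i.toIdx = 1 := if_neg (J.toIdx_ne_idxM i)

theorem weight_idxM : weight (idxM r h) = 2 := if_pos rfl

theorem DK_var_idxM_var (i : Idx (2 * r + 1) (2 * h)) :
    DK F r h (var F _ _ (idxM r h)) (var F _ _ i) = (weight i : F) • var F _ _ i := by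
  rw [DK_var_idxM]
  simp only [LinearMap.add_apply, LinearMap.sum_apply, LinearMap.smul_apply, field_apply, pd_var]
  rcases idx_cases i with rfl | ⟨j, rfl⟩
  · rw [Finset.sum_eq_zero, if_pos rfl, mulO_one, zero_add, weight_idxM, Nat.cast_ofNat]
    intro k _
    rw [if_neg (J.toIdx_ne_idxM k), map_zero]
  · rw [Finset.sum_eq_single j, if_pos rfl, if_neg (J.toIdx_ne_idxM j).symm, mulO_one, map_zero,
      smul_zero, add_zero, weight_toIdx, Nat.cast_one, one_smul]
    · intro k _ hk
      rw [if_neg (fun h1 => hk (J.toIdx_injective h1)), map_zero]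
    · simp

/-- `D_K(x_m)` acts on `D_K(f)`, for `f` of weighted degree `d`, by `d - 2`. -/
theorem superComm_DK_var_idxM {f : O F (2 * r + 1) (2 * h)} {d : F}
    (hf : DK F r h (var F _ _ (idxM r h)) f = d • f) :
    superComm F _ _ (DK F r h (var F _ _ (idxM r h))) (DK F r h f) = (d - 2) • DK F r h f := by
  rw [superComm_DK_of_derivation (c := fun i => (weight i : F)) DK_var_idxM_mem_parEnd
    DK_var_idxM_mulO DK_var_idxM_pd (fun i => DK_var_idxM_var _) _ f, hf, map_smul, sub_smul,
    weight_idxM]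
  · simp
  · intro i
    rw [weight_toIdx, weight_toIdx, weight_idxM]
    norm_num

end ContactFields

end Contact

namespace Contact

section Centralizer

variable {F : Type*} [Field F] {r h : ℕ}

local notation:70 f:70 " ⋆ " g:71 => mulO _ _ _ f g

theorem DK_var_apply_one (i : J r h) :
    DK F r h (var F _ _ i.toIdx) (bas F _ _ (0, ∅)) = 0 :=
  apply_one_of_mem_vectorFields (DK_mem_vectorFields _)

theorem DK_var_apply_var_toIdx (i j : J r h) : ∃ c : F,
    DK F r h (var F _ _ i.toIdx) (var F _ _ j.toIdx) = c • bas F _ _ (0, ∅) := by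
  rw [DK_var_apply, pd_var (idxM r h), if_neg (J.toIdx_ne_idxM j).symm, map_zero, add_zero, pd_var]
  split_ifs
  · exact ⟨_, rfl⟩
  · exact ⟨0, by simp⟩

theorem DK_var_apply_var_idxM (i : J r h) :
    DK F r h (var F _ _ i.toIdx) (var F _ _ (idxM r h)) = var F _ _ i.toIdx := by
  rw [DK_var_apply, pd_var, if_neg (J.toIdx_ne_idxM _), smul_zero, zero_add, pd_var, if_pos rfl,
    mulO_one]

/-- The Heisenberg relations: the fields `D_K(x_i)`, `i ∈ J`, supercommute up to multiples of
`D_K(1) = 2 ∂_m`. -/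
theorem superComm_DK_var_DK_var (h2 : (2 : F) ≠ 0) (i j : J r h) : ∃ c : F,
    superComm F _ _ (DK F r h (var F _ _ i.toIdx)) (DK F r h (var F _ _ j.toIdx))
      = c • DK F r h (bas F _ _ (0, ∅)) := by
  have hD := superComm_mem_vectorFields (DK_mem_vectorFields (F := F) (var F _ _ i.toIdx))
    (DK_mem_vectorFields (F := F) (var F _ _ j.toIdx))
  have hD' := superComm_of_mem (DK_mem_parEnd (F := F) (var_mem_parO i.toIdx))
    (DK_mem_parEnd (F := F) (var_mem_parO j.toIdx))
  have hJ (k : J r h) : superComm F _ _ (DK F r h (var F _ _ i.toIdx))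
      (DK F r h (var F _ _ j.toIdx)) (var F _ _ k.toIdx) = 0 := by
    obtain ⟨c, hc⟩ := DK_var_apply_var_toIdx (F := F) i k
    obtain ⟨d, hd⟩ := DK_var_apply_var_toIdx (F := F) j k
    rw [hD', LinearMap.sub_apply, LinearMap.smul_apply, Module.End.mul_apply,
      Module.End.mul_apply, hc, hd, map_smul, map_smul, DK_var_apply_one, DK_var_apply_one]
    simp
  obtain ⟨c, hc⟩ := DK_var_apply_var_toIdx (F := F) i j
  obtain ⟨d, hd⟩ := DK_var_apply_var_toIdx (F := F) j i
  have hm : superComm F _ _ (DK F r h (var F _ _ i.toIdx)) (DK F r h (var F _ _ j.toIdx))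
      (var F _ _ (idxM r h))
      = (c - superSign F (i.toIdx.par * j.toIdx.par) * d) • bas F _ _ (0, ∅) := by
    rw [hD', LinearMap.sub_apply, LinearMap.smul_apply, Module.End.mul_apply,
      Module.End.mul_apply, DK_var_apply_var_idxM, DK_var_apply_var_idxM, hc, hd, smul_smul,
      sub_smul]
  refine ⟨(c - superSign F (i.toIdx.par * j.toIdx.par) * d) / 2, LinearMap.ext fun f => ?_⟩
  rw [apply_of_mem_vectorFields hD, sum_idx, hm, Finset.sum_eq_zero, zero_add, DK_one, smul_smul,
    div_mul_cancel₀ _ h2, map_smul, LinearMap.smul_apply, one_mulO, LinearMap.smul_apply]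
  intro k _
  rw [hJ, map_zero, LinearMap.zero_apply]

/-- The span of the monomials of weighted degree less than `d`. -/
noncomputable def degreeLT (F : Type*) [CommRing F] (r h d : ℕ) :
    Submodule F (O F (2 * r + 1) (2 * h)) :=
  Submodule.span F (bas F _ _ '' {a | weightedDegree a < d})

theorem bas_mem_degreeLT {a : Mon (2 * r + 1) (2 * h)} {d : ℕ} (ha : weightedDegree a < d) :
    bas F _ _ a ∈ degreeLT F r h d :=
  Submodule.subset_span ⟨a, ha, rfl⟩

theorem weight_pos (i : Idx (2 * r + 1) (2 * h)) : 0 < weight i := by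
  unfold weight; split_ifs <;> norm_num

theorem pd_bas_mem_degreeLT (i : Idx (2 * r + 1) (2 * h)) (a : Mon (2 * r + 1) (2 * h)) :
    pd F _ _ i (bas F _ _ a) ∈ degreeLT F r h (weightedDegree a) := by
  obtain ⟨c, b, hb, hc⟩ := pd_bas_cases (F := F) i a
  rw [hb]
  rcases hc with rfl | hc
  · rw [zero_smul]; exact Submodule.zero_mem _
  · exact Submodule.smul_mem _ _ (bas_mem_degreeLT (by have := weight_pos i; omega))

theorem var_eq_bas {m n : ℕ} (i : Idx m n) : ∃ a, var F m n i = bas F m n a ∧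
    ∀ j, exponent a j = if j = i then 1 else 0 := by
  rcases i with i | k
  · refine ⟨_, rfl, ?_⟩
    rintro (j | l)
    · simp [exponent, Pi.single_apply]
    · simp [exponent]
  · refine ⟨_, rfl, ?_⟩
    rintro (j | l)
    · simp [exponent]
    · simp [exponent]

theorem DK_var_bas_mem_degreeLT (i : J r h) (a : Mon (2 * r + 1) (2 * h)) :
    DK F r h (var F _ _ i.toIdx) (bas F _ _ a) ∈ degreeLT F r h (weightedDegree a) := by
  rw [DK_var_apply]
  refine Submodule.add_mem _ (Submodule.smul_mem _ _ (pd_bas_mem_degreeLT _ _)) ?_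
  obtain ⟨c, b, hb, hc⟩ := pd_bas_cases (F := F) (idxM r h) a
  obtain ⟨v, hv, hv'⟩ := var_eq_bas (F := F) i.toIdx
  rw [hb, hv, map_smul]
  rcases hc with rfl | hc
  · rw [zero_smul]; exact Submodule.zero_mem _
  · refine Submodule.smul_mem _ _ ?_
    by_cases hd : Disjoint v.2 b.2
    · rw [mulO_bas_of_disjoint hd]
      refine Submodule.smul_mem _ _ (bas_mem_degreeLT ?_)
      have : weightedDegree v = 1 := by
        simp [weightedDegree, hv', weight_toIdx]
      rw [weightedDegree_mul hd, this]
      rw [weight_idxM] at hc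
      omega
    · rw [mulO_bas_of_not_disjoint hd]
      exact Submodule.zero_mem _

/-- If the derivatives of `f` along the `D_K(x_i)`, `i ∈ J`, and along `D_K(1)` vanish, then `f`
is constant. -/
theorem eq_constTerm_of_DK_eq_zero (h2 : (2 : F) ≠ 0) {f : O F (2 * r + 1) (2 * h)}
    (h1 : DK F r h (bas F _ _ (0, ∅)) f = 0)
    (hX : ∀ i : J r h, DK F r h (var F _ _ i.toIdx) f = 0) :
    f = constTerm F _ _ f • bas F _ _ (0, ∅) := by
  have hm : pd F _ _ (idxM r h) f = 0 := by
    rw [DK_one, LinearMap.smul_apply] at h1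
    exact (smul_eq_zero.1 h1).resolve_left h2
  refine eq_constTerm_of_pd_eq_zero fun i => ?_
  rcases idx_cases i with rfl | ⟨j, rfl⟩
  · exact hm
  · have hj := hX j.conj
    rw [DK_var_apply, hm, map_zero, add_zero, J.conj_conj] at hj
    refine (smul_eq_zero.1 hj).resolve_left (mul_ne_zero ?_ fun h0 => ?_)
    · rcases ZMod.two_cases j.conj.toIdx.par with h0 | h0 <;> simp [h0]
    · have := J.sigma_mul_self (F := F) j.conj
      simp [h0] at this

/-- A vector field that supercommutes with `D_K(1)` and the `D_K(x_i)`, `i ∈ J`, and vanishes at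
the origin is zero. -/
theorem eq_zero_of_superComm_eq_zero (h2 : (2 : F) ≠ 0) {γ : ZMod 2}
    {D : Module.End F (O F (2 * r + 1) (2 * h))} (hD : D ∈ vectorFields F _ _)
    (hγ : D ∈ parEnd F _ _ γ)
    (h1 : superComm F _ _ (DK F r h (bas F _ _ (0, ∅))) D = 0)
    (hX : ∀ i : J r h, superComm F _ _ (DK F r h (var F _ _ i.toIdx)) D = 0)
    (h0 : ∀ i, constTerm F _ _ (D (var F _ _ i)) = 0) : D = 0 := by
  have hlt (d : ℕ) (hd : ∀ a, weightedDegree a < d → D (bas F _ _ a) = 0)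
      (f : O F (2 * r + 1) (2 * h)) (hf : f ∈ degreeLT F r h d) : D f = 0 := by
    induction hf using Submodule.span_induction with
    | mem x hx => obtain ⟨a, ha, rfl⟩ := hx; exact hd a ha
    | zero => exact map_zero _
    | add x y _ _ hx hy => rw [map_add, hx, hy, add_zero]
    | smul c x _ hx => rw [map_smul, hx, smul_zero]
  have key (d : ℕ) : ∀ a, weightedDegree a = d → D (bas F _ _ a) = 0 := by
    induction d using Nat.strong_induction_on with
    | _ d ih =>
      intro a ha
      have hlt' := hlt d (fun b hb => ih _ hb b rfl)
      have hcomm {β : ZMod 2} {E : Module.End F (O F (2 * r + 1) (2 * h))}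
          (hE : E ∈ parEnd F _ _ β) (hED : superComm F _ _ E D = 0)
          (hEa : E (bas F _ _ a) ∈ degreeLT F r h d) : E (D (bas F _ _ a)) = 0 := by
        have h3 := LinearMap.congr_fun hED (bas F _ _ a)
        rw [superComm_of_mem hE hγ, LinearMap.sub_apply, LinearMap.smul_apply,
          Module.End.mul_apply, Module.End.mul_apply, hlt' _ hEa, smul_zero, sub_zero] at h3
        exact h3
      rw [eq_constTerm_of_DK_eq_zero h2 (hcomm DK_one_mem_parEnd h1 ?_)
        (fun i => hcomm (DK_mem_parEnd (var_mem_parO _)) (hX i) ?_),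
        apply_of_mem_vectorFields hD, map_sum, Finset.sum_eq_zero, zero_smul]
      · intro i _
        rw [constTerm_mulO, h0, zero_mul]
      · rw [DK_one, LinearMap.smul_apply, ← ha]
        exact Submodule.smul_mem _ _ (pd_bas_mem_degreeLT _ _)
      · rw [← ha]
        exact DK_var_bas_mem_degreeLT _ _
  exact (bas F _ _).ext fun a => key _ a rfl

theorem constTerm_DK_var_idxM (f : O F (2 * r + 1) (2 * h)) :
    constTerm F _ _ (DK F r h (var F _ _ (idxM r h)) f) = 0 := by
  induction f using O.induction with
  | hadd f g hf hg => rw [map_add, map_add, hf, hg, add_zero]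
  | hsmul c f hf => rw [map_smul, map_smul, hf, smul_zero]
  | hb a =>
    rw [DK_var_idxM_bas, map_smul, constTerm_bas]
    split_ifs with ha
    · have : ∀ i, exponent a i = 0 := by rintro (i | k) <;> simp [exponent, ha]
      simp [weightedDegree, this]
    · exact smul_zero _

/-- A vector field of weight `k` under `D_K(x_m)` involves `∂_i` with nonzero value at the origin
only if `∂_i` has weight `k`, too. -/
theorem constTerm_apply_var_of_weight {D : Module.End F (O F (2 * r + 1) (2 * h))} {k : F}
    (hT : superComm F _ _ (DK F r h (var F _ _ (idxM r h))) D = k • D)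
    (i : Idx (2 * r + 1) (2 * h)) (hk : k + (weight i : F) ≠ 0) :
    constTerm F _ _ (D (var F _ _ i)) = 0 := by
  have h1 := congrArg (constTerm F _ _) (LinearMap.congr_fun hT (var F _ _ i))
  rw [superComm_of_even DK_var_idxM_mem_parEnd, LinearMap.sub_apply, Module.End.mul_apply,
    Module.End.mul_apply, map_sub, constTerm_DK_var_idxM, DK_var_idxM_var, map_smul, map_smul,
    LinearMap.smul_apply, map_smul, smul_eq_mul, smul_eq_mul] at h1
  exact (mul_eq_zero.1 (show (k + weight i) * constTerm F _ _ (D (var F _ _ i)) = 0 by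
    linear_combination -h1)).resolve_left hk

theorem eq_zero_of_superComm_of_weight (h2 : (2 : F) ≠ 0) {γ : ZMod 2}
    {D : Module.End F (O F (2 * r + 1) (2 * h))} (hD : D ∈ vectorFields F _ _)
    (hγ : D ∈ parEnd F _ _ γ)
    (h1 : superComm F _ _ (DK F r h (bas F _ _ (0, ∅))) D = 0)
    (hX : ∀ i : J r h, superComm F _ _ (DK F r h (var F _ _ i.toIdx)) D = 0) {k : F}
    (hT : superComm F _ _ (DK F r h (var F _ _ (idxM r h))) D = k • D)
    (hk1 : k + 1 ≠ 0) (hk2 : k + 2 ≠ 0) : D = 0 := by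
  refine eq_zero_of_superComm_eq_zero h2 hD hγ h1 hX fun i =>
    constTerm_apply_var_of_weight hT i ?_
  unfold weight
  split_ifs
  · exact_mod_cast hk2
  · exact_mod_cast hk1

theorem eq_smul_of_superComm_of_weight (h2 : (2 : F) ≠ 0)
    {D : Module.End F (O F (2 * r + 1) (2 * h))} (hD : D ∈ vectorFields F _ _)
    (hγ : D ∈ parEnd F _ _ 0)
    (h1 : superComm F _ _ (DK F r h (bas F _ _ (0, ∅))) D = 0)
    (hX : ∀ i : J r h, superComm F _ _ (DK F r h (var F _ _ i.toIdx)) D = 0)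
    (hT : superComm F _ _ (DK F r h (var F _ _ (idxM r h))) D = (-2 : F) • D) :
    ∃ c : F, D = c • DK F r h (bas F _ _ (0, ∅)) := by
  -- The multiple of `D_K(1) = 2 ∂_m` with the same value at the origin.
  set c := constTerm F _ _ (D (var F _ _ (idxM r h))) / 2 with hc
  refine ⟨c, sub_eq_zero.1 (eq_zero_of_superComm_eq_zero h2
    (Submodule.sub_mem _ hD (Submodule.smul_mem _ c (DK_mem_vectorFields _)))
    (Submodule.sub_mem _ hγ (Submodule.smul_mem _ c DK_one_mem_parEnd)) ?_ (fun i => ?_)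
    fun i => ?_)⟩
  · rw [map_sub, h1, map_smul, superComm_DK_one, pd_one]
    simp
  · rw [map_sub, hX, map_smul, superComm_skew (DK_mem_parEnd (var_mem_parO _)) DK_one_mem_parEnd,
      superComm_DK_one, pd_var, if_neg (J.toIdx_ne_idxM i).symm]
    simp
  · rcases idx_cases i with rfl | ⟨j, rfl⟩
    · rw [LinearMap.sub_apply, LinearMap.smul_apply, DK_one, LinearMap.smul_apply, pd_var,
        if_pos rfl, map_sub, map_smul, map_smul, constTerm_bas, if_pos rfl, smul_eq_mul,
        smul_eq_mul, mul_one, hc, div_mul_cancel₀ _ h2, sub_self]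
    · rw [LinearMap.sub_apply, LinearMap.smul_apply, DK_one, LinearMap.smul_apply, pd_var,
        if_neg (J.toIdx_ne_idxM j).symm, smul_zero, smul_zero, sub_zero]
      refine constTerm_apply_var_of_weight hT _ ?_
      rw [weight_toIdx, Nat.cast_one]
      norm_num

/-- When the weight is `-2` and the field is odd, nothing is left. -/
theorem eq_zero_of_superComm_of_odd (h2 : (2 : F) ≠ 0)
    {D : Module.End F (O F (2 * r + 1) (2 * h))} (hD : D ∈ vectorFields F _ _)
    (hγ : D ∈ parEnd F _ _ 1)
    (h1 : superComm F _ _ (DK F r h (bas F _ _ (0, ∅))) D = 0)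
    (hX : ∀ i : J r h, superComm F _ _ (DK F r h (var F _ _ i.toIdx)) D = 0)
    (hT : superComm F _ _ (DK F r h (var F _ _ (idxM r h))) D = (-2 : F) • D) : D = 0 := by
  refine eq_zero_of_superComm_eq_zero h2 hD hγ h1 hX fun i => ?_
  rcases idx_cases i with rfl | ⟨j, rfl⟩
  · have h3 := hγ _ _ (var_mem_parO (idxM r h))
    have h4 (f : O F (2 * r + 1) (2 * h)) (hf : f ∈ parO F _ _ 1) : constTerm F _ _ f = 0 := by
      induction hf using Submodule.span_induction with
      | mem x hx =>
        obtain ⟨a, ha, rfl⟩ := hx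
        rw [constTerm_bas, if_neg]
        rintro rfl
        simp at ha
      | zero => exact map_zero _
      | add x y _ _ hx hy => rw [map_add, hx, hy, add_zero]
      | smul c x _ hx => rw [map_smul, hx, smul_zero]
    exact h4 _ h3
  · refine constTerm_apply_var_of_weight hT _ ?_
    rw [weight_toIdx, Nat.cast_one]
    norm_num

end Centralizer

end Contact

section Superalgebra

variable {F L : Type*} [Field F] [AddCommGroup L] [Module F L]
  {𝒢 : ZMod 2 → Submodule F L} {br : L →ₗ[F] L →ₗ[F] L}

/-! ### Super-biderivations of Lie superalgebras -/

/-- `L`, with the grading `𝒢` and the bracket `br`, is a Lie superalgebra. -/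
structure IsLieSuperalgebra (𝒢 : ZMod 2 → Submodule F L) (br : L →ₗ[F] L →ₗ[F] L) : Prop where
  isCompl : IsCompl (𝒢 0) (𝒢 1)
  degree : ∀ a b : ZMod 2, ∀ x ∈ 𝒢 a, ∀ y ∈ 𝒢 b, br x y ∈ 𝒢 (a + b)
  skew : ∀ a b : ZMod 2, ∀ x ∈ 𝒢 a, ∀ y ∈ 𝒢 b, br x y = -(superSign F (a * b) • br y x)
  jacobi : ∀ a b c : ZMod 2, ∀ x ∈ 𝒢 a, ∀ y ∈ 𝒢 b, ∀ z ∈ 𝒢 c,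
    br x (br y z) = br (br x y) z + superSign F (a * b) • br y (br x z)

theorem superSign_smul_eq_zero {a : ZMod 2} {x : L} (hx : superSign F a • x = 0) : x = 0 := by
  rcases ZMod.two_cases a with rfl | rfl
  · simpa using hx
  · simpa using hx

theorem IsLieSuperalgebra.exists_homogeneous (hL : IsLieSuperalgebra 𝒢 br) (x : L) :
    ∃ y ∈ 𝒢 0, ∃ z ∈ 𝒢 1, y + z = x :=
  Submodule.mem_sup.1 (hL.isCompl.sup_eq_top ▸ Submodule.mem_top)

theorem IsLieSuperalgebra.isSkewSuperBiderivation (hL : IsLieSuperalgebra 𝒢 br) :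
    IsSkewSuperBiderivation 𝒢 br 0 br where
  degree a b x hx y hy := by rw [add_zero]; exact hL.degree a b x hx y hy
  skew := hL.skew
  left a b c x hx y hy z hz := by
    have h1 := hL.jacobi a b c x hx y hy z hz
    have h2 := hL.skew b (a + c) y hy _ (hL.degree a c x hx z hz)
    rcases ZMod.two_cases a with rfl | rfl <;> rcases ZMod.two_cases b with rfl | rfl <;>
      rcases ZMod.two_cases c with rfl | rfl <;>
      simp only [mul_zero, mul_one, superSign_zero, superSign_one, one_smul,
        neg_one_smul, add_zero, zero_add, CharTwo.add_self_eq_zero] at h1 h2 ⊢ <;>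
      rw [h1, h2] <;> abel
  right a b c x hx y hy z hz := by rw [zero_add]; exact hL.jacobi a b c x hx y hy z hz

namespace IsSkewSuperBiderivation

variable {γ : ZMod 2} {φ : L →ₗ[F] L →ₗ[F] L}

set_option maxHeartbeats 2000000 in
/-- The two expansions of `φ([x,u],[y,v])` differ by expressions in `[φ(·,·),[·,·]]` and
`[[·,·],φ(·,·)]`; this is the resulting relation. -/
theorem exchange (hL : IsLieSuperalgebra 𝒢 br) (hφ : IsSkewSuperBiderivation 𝒢 br γ φ)
    {a b c d : ZMod 2} {x y u v : L} (hx : x ∈ 𝒢 a) (hy : y ∈ 𝒢 b) (hu : u ∈ 𝒢 c)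
    (hv : v ∈ 𝒢 d) :
    superSign F (γ * (a + b)) • br (br x y) (φ u v) - br (φ x y) (br u v)
      = superSign F (b * c + c * d + b * d) •
        (superSign F (γ * (a + d)) • br (br x v) (φ u y) - br (φ x v) (br u y)) := by
  have hxy := hφ.degree _ _ _ hx _ hy
  have huv := hφ.degree _ _ _ hu _ hv
  have hxv := hφ.degree _ _ _ hx _ hv
  have huy := hφ.degree _ _ _ hu _ hy
  have w1 := hφ.left _ _ _ _ hx _ hu _ (hL.degree _ _ _ hy _ hv)
  rw [hφ.right _ _ _ _ hu _ hy _ hv, hφ.right _ _ _ _ hx _ hy _ hv] at w1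
  have w2 := hφ.right _ _ _ _ (hL.degree _ _ _ hx _ hu) _ hy _ hv
  rw [hφ.left _ _ _ _ hx _ hu _ hy, hφ.left _ _ _ _ hx _ hu _ hv] at w2
  simp only [map_add, map_smul, LinearMap.add_apply, LinearMap.smul_apply] at w1 w2
  have j1 := hL.jacobi _ _ _ _ hx _ huy _ hv
  have j2 := hL.jacobi _ _ _ _ hx _ hy _ huv
  have j3 := hL.jacobi _ _ _ _ hxy _ hu _ hv
  have j4 := hL.jacobi _ _ _ _ hy _ hxv _ hu
  have s3 := hL.skew _ _ _ hu _ (hL.degree _ _ _ hxy _ hv)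
  have s5 := hL.skew _ _ _ huy _ (hL.degree _ _ _ hx _ hv)
  have s6 : br (φ x v) (br y u) = -(superSign F (b * c) • br (φ x v) (br u y)) := by
    rw [hL.skew _ _ _ hy _ hu, map_neg, map_smul]
  -- `w2 - w1` equates the two expansions; `j1`, …, `j4` contract its double brackets in pairs, and
  -- `s3`, `s5`, `s6` put the results into the required order. The signs are compared case by case.
  linear_combination (norm := skip)
    superSign F (c * b) • (w2 - w1 - superSign F (γ * a) • j1
      - (superSign F (γ * a) * superSign F ((γ + c) * b)) • j2
      - superSign F (c * b) • j3
      - (superSign F (c * b) * superSign F ((a + b + γ) * c)) • s3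
      + (superSign F ((γ + a + c) * b) * superSign F (c * d)) • j4
      - superSign F (a * (b + c)) • s5
      + superSign F (c * b + c * d + b * d) • s6)
  clear w1 w2 j1 j2 j3 j4 s3 s5 s6 hxy huv hxv huy hx hy hu hv
  rcases ZMod.two_cases a with rfl | rfl <;> rcases ZMod.two_cases b with rfl | rfl <;>
    rcases ZMod.two_cases c with rfl | rfl <;> rcases ZMod.two_cases d with rfl | rfl <;>
    rcases ZMod.two_cases γ with rfl | rfl <;>
    simp only [mul_zero, mul_one, superSign_zero, superSign_one, one_smul,
      neg_one_smul, add_zero, zero_add, CharTwo.add_self_eq_zero] <;>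
    module

/-- `[φ(x,y),[u,v]] = ± [[x,y],φ(u,v)]`: the difference of the two sides is skew in `u`, `v`, and
by `exchange` it is super-symmetric as well. -/
theorem br_apply_br (hL : IsLieSuperalgebra 𝒢 br) (hφ : IsSkewSuperBiderivation 𝒢 br γ φ)
    (h2 : (2 : F) ≠ 0) {a b c d : ZMod 2} {x y u v : L} (hx : x ∈ 𝒢 a) (hy : y ∈ 𝒢 b)
    (hu : u ∈ 𝒢 c) (hv : v ∈ 𝒢 d) :
    br (φ x y) (br u v) = superSign F (γ * (a + b)) • br (br x y) (φ u v) := by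
  have hskew {b c d : ZMod 2} {y u v : L} (hu : u ∈ 𝒢 c) (hv : v ∈ 𝒢 d) :
      superSign F (γ * (a + b)) • br (br x y) (φ u v) - br (φ x y) (br u v)
        = -(superSign F (c * d) •
          (superSign F (γ * (a + b)) • br (br x y) (φ v u) - br (φ x y) (br v u))) := by
    rw [hφ.skew _ _ _ hu _ hv, hL.skew _ _ _ hu _ hv, map_neg, map_neg, map_smul, map_smul]
    module
  -- Exchanges and transpositions lead from `(y, u, v)` back to `(y, u, v)` with total sign `-1`.
  have e1 := exchange hL hφ hx hy hu hv
  have e2 := hskew (b := d) (y := v) hu hy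
  have e3 := exchange hL hφ hx hv hy hu
  have e4 := hskew (b := c) (y := u) hy hv
  have e5 := exchange hL hφ hx hu hv hy
  have e6 := hskew (b := b) (y := y) hv hu
  rw [e2, e3, e4, e5, e6] at e1
  have e7 : (2 : F) •
      (superSign F (γ * (a + b)) • br (br x y) (φ u v) - br (φ x y) (br u v)) = 0 := by
    generalize superSign F (γ * (a + b)) • br (br x y) (φ u v) - br (φ x y) (br u v) = E at e1 ⊢
    rcases ZMod.two_cases b with rfl | rfl <;>
      rcases ZMod.two_cases c with rfl | rfl <;> rcases ZMod.two_cases d with rfl | rfl <;>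
      simp only [mul_zero, mul_one, superSign_zero, superSign_one, one_smul,
        neg_one_smul, add_zero, zero_add, CharTwo.add_self_eq_zero] at e1 <;>
      rw [two_smul] <;> nth_rewrite 1 [e1] <;> simp
  exact (sub_eq_zero.1 ((smul_eq_zero.1 e7).resolve_left h2)).symm

end IsSkewSuperBiderivation

/-- Elements `e`, `T`, `Q`, `X_i`, `Y_i` of a Lie superalgebra with the relations between `D_K(1)`,
`D_K(x_m)`, `D_K(x_m^(2))`, `D_K(x_i)`, `D_K(x_i x_m)`, and such that the weights of `T` on the
centralizer of `e` and the `X_i` are `-1` and `-2`, only `e` having the weight `-2`. -/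
structure IsContactFrame (𝒢 : ZMod 2 → Submodule F L) (br : L →ₗ[F] L →ₗ[F] L) {ι : Type*}
    (π : ι → ZMod 2) (e T Q : L) (X Y : ι → L) : Prop where
  e_mem : e ∈ 𝒢 0
  T_mem : T ∈ 𝒢 0
  Q_mem : Q ∈ 𝒢 0
  X_mem : ∀ i, X i ∈ 𝒢 (π i)
  Y_mem : ∀ i, Y i ∈ 𝒢 (π i)
  e_X : ∀ i, br e (X i) = 0
  e_T : br e T = (2 : F) • e
  e_Y : ∀ i, br e (Y i) = (2 : F) • X i
  e_Q : br e Q = (2 : F) • T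
  T_X : ∀ i, br T (X i) = -X i
  T_Y : ∀ i, br T (Y i) = Y i
  T_Q : br T Q = (2 : F) • Q
  X_X : ∀ i j, ∃ c : F, br (X i) (X j) = c • e
  eq_zero : ∀ γ, ∀ D ∈ 𝒢 γ, br e D = 0 → (∀ i, br (X i) D = 0) → ∀ k : F, br T D = k • D →
    k + 1 ≠ 0 → k + 2 ≠ 0 → D = 0
  eq_smul : ∀ D ∈ 𝒢 0, br e D = 0 → (∀ i, br (X i) D = 0) → br T D = (-2 : F) • D →
    ∃ c : F, D = c • e
  eq_zero_of_odd : ∀ D ∈ 𝒢 1, br e D = 0 → (∀ i, br (X i) D = 0) → br T D = (-2 : F) • D → D = 0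

namespace IsContactFrame

variable {ι : Type*} {π : ι → ZMod 2} {e T Q : L} {X Y : ι → L} {γ : ZMod 2}
  {φ : L →ₗ[F] L →ₗ[F] L}

theorem br_self_of_even (hL : IsLieSuperalgebra 𝒢 br) (h2 : (2 : F) ≠ 0) {x : L} (hx : x ∈ 𝒢 0) :
    br x x = 0 := by
  have h1 := hL.skew _ _ _ hx _ hx
  rw [mul_zero, superSign_zero, one_smul] at h1
  have h3 : (2 : F) • br x x = 0 := by rw [two_smul]; nth_rewrite 1 [h1]; simp
  exact (smul_eq_zero.1 h3).resolve_left h2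

theorem br_eq_zero_comm (hL : IsLieSuperalgebra 𝒢 br) {a b : ZMod 2} {x y : L} (hx : x ∈ 𝒢 a)
    (hy : y ∈ 𝒢 b) (hxy : br x y = 0) : br y x = 0 := by
  rw [hL.skew _ _ _ hy _ hx, hxy, smul_zero, neg_zero]

/-- A homogeneous element that commutes with `[e,T]`, `[e,Y_i]` and `[e,Q]` is zero. -/
theorem eq_zero_of_br_br (hL : IsLieSuperalgebra 𝒢 br) (hC : IsContactFrame 𝒢 br π e T Q X Y)
    (h2 : (2 : F) ≠ 0) {a : ZMod 2} {z : L} (hz : z ∈ 𝒢 a) (hT : br z (br e T) = 0)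
    (hY : ∀ i, br z (br e (Y i)) = 0) (hQ : br z (br e Q) = 0) : z = 0 := by
  rw [hC.e_T, map_smul] at hT
  rw [hC.e_Q, map_smul] at hQ
  refine hC.eq_zero a z hz
    (br_eq_zero_comm hL hz hC.e_mem ((smul_eq_zero.1 hT).resolve_left h2)) (fun i => ?_) 0 ?_
    (by simp) (by simpa using h2)
  · have h1 := hY i
    rw [hC.e_Y, map_smul] at h1
    exact br_eq_zero_comm hL hz (hC.X_mem i) ((smul_eq_zero.1 h1).resolve_left h2)
  · rw [zero_smul]
    exact br_eq_zero_comm hL hz hC.T_mem ((smul_eq_zero.1 hQ).resolve_left h2)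

theorem apply_eq_zero_of_br_eq_zero (hL : IsLieSuperalgebra 𝒢 br)
    (hC : IsContactFrame 𝒢 br π e T Q X Y) (hφ : IsSkewSuperBiderivation 𝒢 br γ φ)
    (h2 : (2 : F) ≠ 0) {a b : ZMod 2} {x y : L} (hx : x ∈ 𝒢 a) (hy : y ∈ 𝒢 b)
    (hxy : br x y = 0) : φ x y = 0 := by
  have key {d : ZMod 2} {v : L} (hv : v ∈ 𝒢 d) : br (φ x y) (br e v) = 0 := by
    rw [hφ.br_apply_br hL h2 hx hy hC.e_mem hv, hxy, map_zero, LinearMap.zero_apply, smul_zero]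
  exact hC.eq_zero_of_br_br hL h2 (hφ.degree _ _ _ hx _ hy) (key hC.T_mem)
    (fun i => key (hC.Y_mem i)) (key hC.Q_mem)

theorem apply_e_eq_zero_of_br_eq_zero (hL : IsLieSuperalgebra 𝒢 br)
    (hC : IsContactFrame 𝒢 br π e T Q X Y) (hφ : IsSkewSuperBiderivation 𝒢 br γ φ)
    (h2 : (2 : F) ≠ 0) {y : L} (hy : br e y = 0) : φ e y = 0 := by
  obtain ⟨v, hv, w, hw, rfl⟩ := hL.exists_homogeneous y
  rw [map_add] at hy
  have hv' := hL.degree _ _ _ hC.e_mem _ hv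
  have hw' := hL.degree _ _ _ hC.e_mem _ hw
  rw [zero_add] at hv' hw'
  have h0 : br e v = 0 := by
    refine Submodule.disjoint_def.1 hL.isCompl.disjoint _ hv' ?_
    rw [eq_neg_of_add_eq_zero_left hy]
    exact Submodule.neg_mem _ hw'
  rw [h0, zero_add] at hy
  rw [map_add, hC.apply_eq_zero_of_br_eq_zero hL hφ h2 hC.e_mem hv h0,
    hC.apply_eq_zero_of_br_eq_zero hL hφ h2 hC.e_mem hw hy, add_zero]

/-- The superderivation `φ(e, ·)` supercommutes with the centralizer of `e`. -/
theorem br_apply_e_eq_zero (hL : IsLieSuperalgebra 𝒢 br)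
    (hC : IsContactFrame 𝒢 br π e T Q X Y) (hφ : IsSkewSuperBiderivation 𝒢 br γ φ)
    (h2 : (2 : F) ≠ 0) {a b : ZMod 2} {u v : L} (hu : u ∈ 𝒢 a) (hv : v ∈ 𝒢 b)
    (heu : br e u = 0) (huv : φ e (br u v) = 0) : br u (φ e v) = 0 := by
  rw [hφ.right _ _ _ _ hC.e_mem _ hu _ hv, hC.apply_e_eq_zero_of_br_eq_zero hL hφ h2 heu, map_zero,
    LinearMap.zero_apply, zero_add] at huv
  exact superSign_smul_eq_zero huv

theorem T_e (hL : IsLieSuperalgebra 𝒢 br) (hC : IsContactFrame 𝒢 br π e T Q X Y) :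
    br T e = (-2 : F) • e := by
  rw [hL.skew _ _ _ hC.T_mem _ hC.e_mem, hC.e_T, mul_zero, superSign_zero, one_smul, neg_smul]

theorem X_T (hL : IsLieSuperalgebra 𝒢 br) (hC : IsContactFrame 𝒢 br π e T Q X Y) (i : ι) :
    br (X i) T = X i := by
  rw [hL.skew _ _ _ (hC.X_mem i) _ hC.T_mem, hC.T_X, mul_zero, superSign_zero, one_smul, neg_neg]

theorem apply_e_e (hL : IsLieSuperalgebra 𝒢 br)
    (hC : IsContactFrame 𝒢 br π e T Q X Y) (hφ : IsSkewSuperBiderivation 𝒢 br γ φ)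
    (h2 : (2 : F) ≠ 0) : φ e e = 0 :=
  hC.apply_e_eq_zero_of_br_eq_zero hL hφ h2 (br_self_of_even hL h2 hC.e_mem)

theorem br_e_apply_e_T (hL : IsLieSuperalgebra 𝒢 br)
    (hC : IsContactFrame 𝒢 br π e T Q X Y) (hφ : IsSkewSuperBiderivation 𝒢 br γ φ)
    (h2 : (2 : F) ≠ 0) : br e (φ e T) = 0 := by
  refine hC.br_apply_e_eq_zero hL hφ h2 hC.e_mem hC.T_mem (br_self_of_even hL h2 hC.e_mem) ?_
  rw [hC.e_T, map_smul, hC.apply_e_e hL hφ h2, smul_zero]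

theorem br_X_apply_e_T (hL : IsLieSuperalgebra 𝒢 br)
    (hC : IsContactFrame 𝒢 br π e T Q X Y) (hφ : IsSkewSuperBiderivation 𝒢 br γ φ)
    (h2 : (2 : F) ≠ 0) (i : ι) : br (X i) (φ e T) = 0 := by
  refine hC.br_apply_e_eq_zero hL hφ h2 (hC.X_mem i) hC.T_mem (hC.e_X i) ?_
  rw [hC.X_T hL, hC.apply_e_eq_zero_of_br_eq_zero hL hφ h2 (hC.e_X i)]

theorem br_T_apply_e_T (hL : IsLieSuperalgebra 𝒢 br)
    (hC : IsContactFrame 𝒢 br π e T Q X Y) (hφ : IsSkewSuperBiderivation 𝒢 br γ φ)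
    (h2 : (2 : F) ≠ 0) : br T (φ e T) = (-2 : F) • φ e T := by
  have h1 := hφ.right _ _ _ _ hC.T_mem _ hC.T_mem _ hC.e_mem
  rw [hC.apply_eq_zero_of_br_eq_zero hL hφ h2 hC.T_mem hC.T_mem
    (br_self_of_even hL h2 hC.T_mem), map_zero, LinearMap.zero_apply, zero_add, hC.T_e hL,
    map_smul, mul_zero, superSign_zero, one_smul, hφ.skew _ _ _ hC.T_mem _ hC.e_mem, mul_zero,
    superSign_zero, one_smul, map_neg, smul_neg, neg_inj] at h1
  exact h1.symm

/-- A super-biderivation with `φ(e,T) = 0` is zero. -/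
theorem eq_zero_of_apply_e_T (hL : IsLieSuperalgebra 𝒢 br)
    (hC : IsContactFrame 𝒢 br π e T Q X Y) (hφ : IsSkewSuperBiderivation 𝒢 br γ φ)
    (h2 : (2 : F) ≠ 0) (h3 : (3 : F) ≠ 0) (hT : φ e T = 0) : φ = 0 := by
  have hee := br_self_of_even hL h2 hC.e_mem
  have heX (i : ι) : φ e (X i) = 0 := hC.apply_e_eq_zero_of_br_eq_zero hL hφ h2 (hC.e_X i)
  have hbrT {b : ZMod 2} {v : L} (hv : v ∈ 𝒢 b) : br T (φ e v) = φ e (br T v) := by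
    have h1 := hφ.right _ _ _ _ hC.e_mem _ hC.T_mem _ hv
    rw [hT, map_zero, LinearMap.zero_apply, zero_add, mul_zero, superSign_zero, one_smul] at h1
    exact h1.symm
  have hmem {b : ZMod 2} {v : L} (hv : v ∈ 𝒢 b) : φ e v ∈ 𝒢 (b + γ) := by
    simpa using hφ.degree _ _ _ hC.e_mem _ hv
  have heY (i : ι) : φ e (Y i) = 0 := by
    refine hC.eq_zero _ _ (hmem (hC.Y_mem i)) ?_ (fun j => ?_) 1 ?_ ?_ ?_
    · refine hC.br_apply_e_eq_zero hL hφ h2 hC.e_mem (hC.Y_mem i) hee ?_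
      rw [hC.e_Y, map_smul, heX, smul_zero]
    · -- `[X_j, Y_i]` differs from a multiple of `T` by an element of the centralizer of `e`.
      refine hC.br_apply_e_eq_zero hL hφ h2 (hC.X_mem j) (hC.Y_mem i) (hC.e_X j) ?_
      obtain ⟨c, hc⟩ := hC.X_X j i
      have h4 : br e (br (X j) (Y i) - c • T) = 0 := by
        rw [map_sub, map_smul, hC.e_T, hL.jacobi _ _ _ _ hC.e_mem _ (hC.X_mem j) _ (hC.Y_mem i),
          hC.e_X, map_zero, LinearMap.zero_apply, hC.e_Y, map_smul, hc, zero_mul, superSign_zero,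
          one_smul, zero_add, smul_comm, sub_self]
      have h5 := hC.apply_e_eq_zero_of_br_eq_zero hL hφ h2 h4
      rwa [map_sub, map_smul, hT, smul_zero, sub_zero] at h5
    · rw [hbrT (hC.Y_mem i), hC.T_Y, one_smul]
    · norm_num [h2]
    · norm_num [h3]
  have heQ : φ e Q = 0 := by
    refine hC.eq_zero _ _ (hmem hC.Q_mem) ?_ (fun j => ?_) 2 ?_ ?_ ?_
    · refine hC.br_apply_e_eq_zero hL hφ h2 hC.e_mem hC.Q_mem hee ?_
      rw [hC.e_Q, map_smul, hT, smul_zero]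
    · -- `[X_j, Q]` differs from `Y_j` by an element of the centralizer of `e`.
      refine hC.br_apply_e_eq_zero hL hφ h2 (hC.X_mem j) hC.Q_mem (hC.e_X j) ?_
      have h4 : br e (br (X j) Q - Y j) = 0 := by
        rw [map_sub, hL.jacobi _ _ _ _ hC.e_mem _ (hC.X_mem j) _ hC.Q_mem, hC.e_X, map_zero,
          LinearMap.zero_apply, hC.e_Q, map_smul, hC.X_T hL, hC.e_Y, zero_mul, superSign_zero,
          one_smul, zero_add, sub_self]
      have h5 := hC.apply_e_eq_zero_of_br_eq_zero hL hφ h2 h4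
      rwa [map_sub, heY, sub_zero] at h5
    · rw [hbrT hC.Q_mem, hC.T_Q, map_smul]
    · norm_num [h3]
    · rw [show (2 : F) + 2 = 2 * 2 by norm_num]
      exact mul_ne_zero h2 h2
  have key {a b : ZMod 2} {x y : L} (hx : x ∈ 𝒢 a) (hy : y ∈ 𝒢 b) : φ x y = 0 := by
    have h4 {d : ZMod 2} {v : L} (hv : v ∈ 𝒢 d) (hev : φ e v = 0) :
        br (φ x y) (br e v) = 0 := by
      rw [hφ.br_apply_br hL h2 hx hy hC.e_mem hv, hev, map_zero, smul_zero]
    exact hC.eq_zero_of_br_br hL h2 (hφ.degree _ _ _ hx _ hy) (h4 hC.T_mem hT)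
      (fun i => h4 (hC.Y_mem i) (heY i)) (h4 hC.Q_mem heQ)
  refine LinearMap.ext fun x => LinearMap.ext fun y => ?_
  obtain ⟨x₀, hx₀, x₁, hx₁, rfl⟩ := hL.exists_homogeneous x
  obtain ⟨y₀, hy₀, y₁, hy₁, rfl⟩ := hL.exists_homogeneous y
  simp only [map_add, LinearMap.add_apply, key hx₀ hy₀, key hx₀ hy₁, key hx₁ hy₀, key hx₁ hy₁,
    add_zero, LinearMap.zero_apply]

/-- The super-biderivations of a Lie superalgebra with a contact frame are inner. -/
theorem superBDer_eq_superIBDer (hL : IsLieSuperalgebra 𝒢 br)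
    (hC : IsContactFrame 𝒢 br π e T Q X Y) (h2 : (2 : F) ≠ 0) (h3 : (3 : F) ≠ 0) :
    superBDer 𝒢 br = superIBDer br := by
  have hbr : br ∈ superBDerHom 𝒢 br 0 := hL.isSkewSuperBiderivation
  refine le_antisymm (sup_le ?_ ?_) ?_
  · intro φ hφ
    have hφ' : IsSkewSuperBiderivation 𝒢 br 0 φ := hφ
    obtain ⟨c, hc⟩ := hC.eq_smul (φ e T) (by simpa using hφ'.degree _ _ _ hC.e_mem _ hC.T_mem)
      (hC.br_e_apply_e_T hL hφ' h2) (hC.br_X_apply_e_T hL hφ' h2) (hC.br_T_apply_e_T hL hφ' h2)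
    -- Since `[e,T] = 2e`, the scalar is `c / 2`.
    have h4 : φ - (c / 2) • br = 0 :=
      hC.eq_zero_of_apply_e_T hL
        (show φ - (c / 2) • br ∈ superBDerHom 𝒢 br 0 from
          Submodule.sub_mem _ hφ (Submodule.smul_mem _ _ hbr)) h2 h3 (by
        rw [LinearMap.sub_apply, LinearMap.sub_apply, LinearMap.smul_apply, LinearMap.smul_apply,
          hc, hC.e_T, smul_smul, div_mul_cancel₀ _ h2, sub_self])
    refine ⟨c / 2, fun x y => ?_⟩
    rw [sub_eq_zero.1 h4]
    rfl
  · intro φ hφ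
    have hφ' : IsSkewSuperBiderivation 𝒢 br 1 φ := hφ
    have h4 : φ = 0 := hC.eq_zero_of_apply_e_T hL hφ' h2 h3
      (hC.eq_zero_of_odd (φ e T) (by simpa using hφ'.degree _ _ _ hC.e_mem _ hC.T_mem)
        (hC.br_e_apply_e_T hL hφ' h2) (hC.br_X_apply_e_T hL hφ' h2)
        (hC.br_T_apply_e_T hL hφ' h2))
    rw [h4]
    exact Submodule.zero_mem _
  · rintro φ ⟨c, hc⟩
    have h4 : φ = c • br := LinearMap.ext fun x => LinearMap.ext fun y => hc x y
    rw [h4]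
    exact Submodule.mem_sup_left (Submodule.smul_mem _ _ hbr)

end IsContactFrame

end Superalgebra

namespace Contact

section Algebra

variable {F : Type*} [Field F] {r h p : ℕ} {t : Fin (2 * r + 1) → ℕ}

local notation:70 f:70 " ⋆ " g:71 => mulO _ _ _ f g

/-! ### The contact Lie superalgebra -/

theorem K_le_vectorFields : K F r h p t ≤ vectorFields F _ _ := by
  refine sInf_le ⟨fun D hD E hE => ?_, fun D hD E hE => superComm_mem_vectorFields hD hE⟩
  obtain ⟨f, -, rfl⟩ := hD
  obtain ⟨g, -, rfl⟩ := hE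
  exact superComm_mem_vectorFields (DK_mem_vectorFields f) (DK_mem_vectorFields g)

theorem superComm_DK_mem_K {f g : O F (2 * r + 1) (2 * h)} (hf : f ∈ truncO F _ _ p t)
    (hg : g ∈ truncO F _ _ p t) : superComm F _ _ (DK F r h f) (DK F r h g) ∈ K F r h p t :=
  (Submodule.mem_sInf).2 fun _ hN => hN.1 _ ⟨f, hf, rfl⟩ _ ⟨g, hg, rfl⟩

theorem partEnd_DK (γ : ZMod 2) (f : O F (2 * r + 1) (2 * h)) :
    partEnd F _ _ γ (DK F r h f) = DK F r h (projO F _ _ γ f) := by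
  conv_lhs => rw [← projO_zero_add_one f]
  rw [map_add, map_add, partEnd_of_mem (DK_mem_parEnd (projO_mem 0 f)),
    partEnd_of_mem (DK_mem_parEnd (projO_mem 1 f))]
  rcases ZMod.two_cases γ with rfl | rfl <;> simp

theorem projO_mem_truncO (γ : ZMod 2) {f : O F (2 * r + 1) (2 * h)}
    (hf : f ∈ truncO F _ _ p t) : projO F _ _ γ f ∈ truncO F _ _ p t := by
  induction hf using Submodule.span_induction with
  | mem x hx =>
    obtain ⟨a, ha, rfl⟩ := hx
    rw [projO_bas]
    split_ifs
    · exact Submodule.subset_span ⟨a, ha, rfl⟩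
    · exact Submodule.zero_mem _
  | zero => rw [map_zero]; exact Submodule.zero_mem _
  | add x y _ _ hx hy => rw [map_add]; exact Submodule.add_mem _ hx hy
  | smul c x _ hx => rw [map_smul]; exact Submodule.smul_mem _ _ hx

/-- `K(m,n;t)` is a graded subspace of `End(𝒪(m,n))`. -/
theorem partEnd_mem_K {D : Module.End F (O F (2 * r + 1) (2 * h))} (hD : D ∈ K F r h p t)
    (γ : ZMod 2) : partEnd F _ _ γ D ∈ K F r h p t := by
  -- The elements of `K(m,n;t)` with homogeneous parts in `K(m,n;t)` form a subalgebra.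
  have hle : K F r h p t ≤ ⨅ γ : ZMod 2, (K F r h p t).comap (partEnd F _ _ γ) := by
    refine sInf_le ⟨fun D hD E hE => ?_, fun D hD E hE => ?_⟩
    · obtain ⟨f, hf, rfl⟩ := hD
      obtain ⟨g, hg, rfl⟩ := hE
      refine (Submodule.mem_iInf _).2 fun γ => ?_
      rw [Submodule.mem_comap, partEnd_superComm, partEnd_DK, partEnd_DK, partEnd_DK, partEnd_DK]
      exact Submodule.add_mem _
        (superComm_DK_mem_K (projO_mem_truncO _ hf) (projO_mem_truncO _ hg))
        (superComm_DK_mem_K (projO_mem_truncO _ hf) (projO_mem_truncO _ hg))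
    · rw [Submodule.mem_iInf] at hD hE ⊢
      intro γ
      rw [Submodule.mem_comap, partEnd_superComm]
      exact Submodule.add_mem _ (superComm_mem_K F r h p t (hD 0) (hE γ))
        (superComm_mem_K F r h p t (hD 1) (hE (γ + 1)))
  exact (Submodule.mem_iInf _).1 (hle hD) γ

theorem isLieSuperalgebra_K : IsLieSuperalgebra (parK F r h p t) (bracketK F r h p t) where
  isCompl := by
    refine ⟨Submodule.disjoint_def.2 fun D h0 h1 => Subtype.ext ?_,
      codisjoint_iff.2 (eq_top_iff.2 fun D _ => Submodule.mem_sup.2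
        ⟨⟨partEnd F _ _ 0 D, partEnd_mem_K D.2 0⟩, partEnd_mem 0 D.1,
          ⟨partEnd F _ _ 1 D, partEnd_mem_K D.2 1⟩, partEnd_mem 1 D.1,
          Subtype.ext (partEnd_zero_add_one D.1)⟩)⟩
    have h2 := partEnd_of_mem (show D.1 ∈ parEnd F _ _ 0 from h0) 1
    rw [partEnd_of_mem (show D.1 ∈ parEnd F _ _ 1 from h1) 1] at h2
    simpa using h2
  degree _ _ _ hx _ hy := superComm_mem_parEnd hx hy
  skew _ _ _ hx _ hy := Subtype.ext (superComm_skew hx hy)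
  jacobi _ _ _ _ hx _ hy _ hz := Subtype.ext (superComm_jacobi hx hy hz)

theorem bas_mem_truncO {a : Mon (2 * r + 1) (2 * h)} (hpt : ∀ i, 2 ≤ p ^ t i - 1)
    (ha : ∀ i, a.1 i ≤ 2) : bas F _ _ a ∈ truncO F _ _ p t :=
  Submodule.subset_span ⟨a, fun i => (ha i).trans (hpt i), rfl⟩

theorem var_mem_truncO (hpt : ∀ i, 2 ≤ p ^ t i - 1) (i : Idx (2 * r + 1) (2 * h)) :
    var F _ _ i ∈ truncO F _ _ p t := by
  rcases i with i | k
  · refine bas_mem_truncO hpt fun j => ?_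
    rcases eq_or_ne j i with rfl | hj <;> simp [*]
  · exact bas_mem_truncO hpt fun j => by simp

theorem var_mulO_var_mem_truncO (hpt : ∀ i, 2 ≤ p ^ t i - 1) (i j : Idx (2 * r + 1) (2 * h)) :
    var F _ _ i ⋆ var F _ _ j ∈ truncO F _ _ p t := by
  obtain ⟨a, ha, ha'⟩ := var_eq_bas (F := F) i
  obtain ⟨b, hb, hb'⟩ := var_eq_bas (F := F) j
  rw [ha, hb]
  by_cases hab : Disjoint a.2 b.2
  · rw [mulO_bas_of_disjoint hab]
    refine Submodule.smul_mem _ _ (bas_mem_truncO hpt fun k => ?_)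
    have h1 := ha' (Sum.inl k)
    have h2 := hb' (Sum.inl k)
    simp only [exponent] at h1 h2
    rw [show (a.1 + b.1, a.2 ∪ b.2).1 k = a.1 k + b.1 k from rfl, h1, h2]
    split_ifs <;> norm_num
  · rw [mulO_bas_of_not_disjoint hab]
    exact Submodule.zero_mem _

/-- The divided square `x_m^(2)`. -/
noncomputable def squareM (F : Type*) [CommRing F] (r h : ℕ) : O F (2 * r + 1) (2 * h) :=
  bas F _ _ (Pi.single (Fin.last (2 * r)) 2, ∅)

theorem squareM_mem_truncO (hpt : ∀ i, 2 ≤ p ^ t i - 1) :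
    squareM F r h ∈ truncO F _ _ p t := by
  refine bas_mem_truncO hpt fun j => ?_
  rcases eq_or_ne j (Fin.last (2 * r)) with rfl | hj <;> simp [*]

theorem squareM_mem_parO : squareM F r h ∈ parO F _ _ 0 := by
  simpa [squareM] using bas_mem_parO (F := F)
    ((Pi.single (Fin.last (2 * r)) 2 : Fin (2 * r + 1) → ℕ), (∅ : Finset (Fin (2 * h))))

theorem pd_squareM : pd F _ _ (idxM r h) (squareM F r h) = var F _ _ (idxM r h) := by
  have h1 : (Pi.single (Fin.last (2 * r)) 2 - Pi.single (Fin.last (2 * r)) 1 :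
      Fin (2 * r + 1) → ℕ) = Pi.single (Fin.last (2 * r)) 1 := by
    ext j
    rcases eq_or_ne j (Fin.last (2 * r)) with rfl | hj <;> simp [*]
  simp [squareM, idxM, pd_inl_bas, var, h1]

theorem DK_var_idxM_squareM :
    DK F r h (var F _ _ (idxM r h)) (squareM F r h) = (4 : F) • squareM F r h := by
  rw [squareM, DK_var_idxM_bas, weightedDegree, sum_idx, Finset.sum_eq_zero, weight_idxM]
  · simp only [exponent, idxM, Pi.single_eq_same]
    norm_num
  · rintro (i | k) _
    · simp [J.toIdx, exponent, (Fin.castSucc_lt_last i).ne]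
    · simp [J.toIdx, exponent]

theorem pd_var_mulO_var (i : J r h) :
    pd F _ _ (idxM r h) (var F _ _ i.toIdx ⋆ var F _ _ (idxM r h)) = var F _ _ i.toIdx := by
  have hm : (idxM r h).par = 0 := rfl
  obtain ⟨a, ha, -⟩ := var_eq_bas (F := F) i.toIdx
  have h1 := pd_var (F := F) (idxM r h) i.toIdx
  rw [if_neg (J.toIdx_ne_idxM i).symm, ha] at h1
  rw [ha, pd_mulO_bas, h1, hm, pd_var, if_pos rfl, zero_mul, superSign_zero, one_smul, mulO_one,
    map_zero, LinearMap.zero_apply, zero_add]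

theorem DK_var_idxM_var_mulO_var (i : J r h) :
    DK F r h (var F _ _ (idxM r h)) (var F _ _ i.toIdx ⋆ var F _ _ (idxM r h))
      = (3 : F) • (var F _ _ i.toIdx ⋆ var F _ _ (idxM r h)) := by
  rw [DK_var_idxM_mulO, DK_var_idxM_var, DK_var_idxM_var, weight_toIdx, weight_idxM, map_smul,
    map_smul, LinearMap.smul_apply, ← add_smul]
  norm_num

theorem superComm_T_one :
    superComm F _ _ (DK F r h (var F _ _ (idxM r h))) (DK F r h (bas F _ _ (0, ∅)))
      = (-2 : F) • DK F r h (bas F _ _ (0, ∅)) := by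
  rw [superComm_DK_var_idxM (d := 0)]
  · simp
  · rw [apply_one_of_mem_vectorFields (DK_mem_vectorFields _), zero_smul]

theorem superComm_T_var (i : J r h) :
    superComm F _ _ (DK F r h (var F _ _ (idxM r h))) (DK F r h (var F _ _ i.toIdx))
      = -DK F r h (var F _ _ i.toIdx) := by
  rw [superComm_DK_var_idxM (d := 1)]
  · norm_num
  · rw [DK_var_idxM_var, weight_toIdx, Nat.cast_one]

theorem superComm_T_var_mulO_var (i : J r h) :
    superComm F _ _ (DK F r h (var F _ _ (idxM r h)))
      (DK F r h (var F _ _ i.toIdx ⋆ var F _ _ (idxM r h)))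
      = DK F r h (var F _ _ i.toIdx ⋆ var F _ _ (idxM r h)) := by
  rw [superComm_DK_var_idxM (DK_var_idxM_var_mulO_var i)]
  norm_num

theorem superComm_T_squareM :
    superComm F _ _ (DK F r h (var F _ _ (idxM r h))) (DK F r h (squareM F r h))
      = (2 : F) • DK F r h (squareM F r h) := by
  rw [superComm_DK_var_idxM DK_var_idxM_squareM]
  norm_num

theorem DK_mem_K_of_superComm_T (hpt : ∀ i, 2 ≤ p ^ t i - 1) {f : O F (2 * r + 1) (2 * h)}
    (hf : f ∈ truncO F _ _ p t) {c : F} (hc : c ≠ 0)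
    (hT : superComm F _ _ (DK F r h (var F _ _ (idxM r h))) (DK F r h f) = c • DK F r h f) :
    DK F r h f ∈ K F r h p t := by
  have h1 := superComm_DK_mem_K (var_mem_truncO hpt (idxM r h)) hf
  rw [hT] at h1
  exact (Submodule.smul_mem_iff _ hc).1 h1

theorem DK_var_idxM_mem_K (h2 : (2 : F) ≠ 0) (hpt : ∀ i, 2 ≤ p ^ t i - 1) :
    DK F r h (var F _ _ (idxM r h)) ∈ K F r h p t := by
  have h1 := superComm_DK_mem_K (F := F) (h := h) (bas_mem_truncO (a := (0, ∅)) hpt (by simp))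
    (squareM_mem_truncO hpt)
  rw [superComm_DK_one, pd_squareM] at h1
  exact (Submodule.smul_mem_iff _ h2).1 h1

/-- `D_K(1)`, `D_K(x_m)`, `D_K(x_m^(2))`, `D_K(x_i)` and `D_K(x_i x_m)`, `i ∈ J`, are a contact
frame of `K(m,n;t)`. -/
theorem isContactFrame_K (h2 : (2 : F) ≠ 0) (hpt : ∀ i, 2 ≤ p ^ t i - 1) :
    IsContactFrame (parK F r h p t) (bracketK F r h p t) (fun i : J r h => i.toIdx.par)
      ⟨_, DK_mem_K_of_superComm_T hpt (bas_mem_truncO (a := (0, ∅)) hpt (by simp))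
        (neg_ne_zero.2 h2) superComm_T_one⟩
      ⟨_, DK_var_idxM_mem_K h2 hpt⟩
      ⟨_, DK_mem_K_of_superComm_T hpt (squareM_mem_truncO hpt) h2 superComm_T_squareM⟩
      (fun i => ⟨_, DK_mem_K_of_superComm_T hpt (var_mem_truncO hpt i.toIdx) (c := -1) (by simp)
        (by rw [superComm_T_var, neg_one_smul])⟩)
      (fun i => ⟨_, DK_mem_K_of_superComm_T hpt (var_mulO_var_mem_truncO hpt i.toIdx (idxM r h))
        (c := 1) one_ne_zero (by rw [superComm_T_var_mulO_var, one_smul])⟩) where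
  e_mem := DK_one_mem_parEnd
  T_mem := DK_var_idxM_mem_parEnd
  Q_mem := DK_mem_parEnd squareM_mem_parO
  X_mem i := DK_mem_parEnd (var_mem_parO _)
  Y_mem i := DK_mem_parEnd
    (add_zero i.toIdx.par ▸ mulO_mem_parO (var_mem_parO i.toIdx) (var_mem_parO (idxM r h)))
  e_X i := Subtype.ext <| (superComm_DK_one _).trans <| by
    rw [pd_var, if_neg (J.toIdx_ne_idxM i).symm, map_zero, smul_zero]; rfl
  e_T := Subtype.ext <| (superComm_DK_one _).trans <| by rw [pd_var, if_pos rfl]; rfl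
  e_Y i := Subtype.ext <| (superComm_DK_one _).trans <| by rw [pd_var_mulO_var]; rfl
  e_Q := Subtype.ext <| (superComm_DK_one _).trans <| by rw [pd_squareM]; rfl
  T_X i := Subtype.ext (superComm_T_var i)
  T_Y i := Subtype.ext (superComm_T_var_mulO_var i)
  T_Q := Subtype.ext superComm_T_squareM
  X_X i j := by
    obtain ⟨c, hc⟩ := superComm_DK_var_DK_var (F := F) h2 i j
    exact ⟨c, Subtype.ext hc⟩
  eq_zero γ D hD he hX k hT hk1 hk2 := Subtype.ext <|
    eq_zero_of_superComm_of_weight h2 (K_le_vectorFields D.2) hD (congrArg Subtype.val he)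
      (fun i => congrArg Subtype.val (hX i)) (congrArg Subtype.val hT) hk1 hk2
  eq_smul D hD he hX hT := by
    obtain ⟨c, hc⟩ := eq_smul_of_superComm_of_weight h2 (K_le_vectorFields D.2) hD
      (congrArg Subtype.val he) (fun i => congrArg Subtype.val (hX i)) (congrArg Subtype.val hT)
    exact ⟨c, Subtype.ext hc⟩
  eq_zero_of_odd D hD he hX hT := Subtype.ext <|
    eq_zero_of_superComm_of_odd h2 (K_le_vectorFields D.2) hD (congrArg Subtype.val he)
      (fun i => congrArg Subtype.val (hX i)) (congrArg Subtype.val hT)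

end Algebra

end Contact

theorem mainTheorem1 (p : ℕ) [Fact p.Prime] (hp : 3 < p) (r h : ℕ) (hh : 0 < h)
    (t : Fin (2 * r + 1) → ℕ) (ht : ∀ i, 0 < t i) :
    superBDer (Contact.parK (ZMod p) r h p t) (Contact.bracketK (ZMod p) r h p t)
      = superIBDer (Contact.bracketK (ZMod p) r h p t) := by
  have hne (k : ℕ) (hk0 : 0 < k) (hk : k < p) : ((k : ℕ) : ZMod p) ≠ 0 := fun h0 =>
    absurd (Nat.le_of_dvd hk0 ((ZMod.natCast_eq_zero_iff k p).1 h0)) (by omega)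
  have h2 : (2 : ZMod p) ≠ 0 := by exact_mod_cast hne 2 (by norm_num) (by omega)
  have h3 : (3 : ZMod p) ≠ 0 := by exact_mod_cast hne 3 (by norm_num) hp
  have hpt (i) : 2 ≤ p ^ t i - 1 := by
    have := Nat.le_self_pow (ht i).ne' p
    omega
  exact (Contact.isContactFrame_K h2 hpt).superBDer_eq_superIBDer
    Contact.isLieSuperalgebra_K h2 h3
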